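/- **Setting.** Let $1\le r\le K$ be integers. A graph on a vertex set $\mathcal V$ with $|\mathcal V|=n$ is undirected and may have self-loops. For every ordered pair $(i,j)$ with $\{i,j\}\in\mathcal E$ there is an intermediate value $v_{i,j}\in\{0,1\}^T$, Mapped from the file of $j$ and needed by the Reduce function of $i$. An allocation $A=(\mathcal M,\mathcal R)$ of computation load $r$ over $K$ machines consists of sets $\mathcal M_1,\dots,\mathcal M_K\subseteq\mathcal V$ with $\bigcup_k\mathcal M_k=\mathcal V$ and $\sum_k|\mathcal M_k|=rn$, and a partition $\mathcal V=\mathcal R_1\sqcup\dots\sqcup\mathcal R_K$ with $|\mathcal R_k|=n/K$ (so $K\mid n$). Let $\mathcal A(r)$ be the set of all these allocations, or the set of those for which moreover $|\mathcal M_k|=rn/K$ for every $k$; the theorem holds for either choice. In a Shuffle scheme for a graph $G$ and allocation $A$, machine $k$ multicasts a message of $c_k$ bits that is a function of its local values $\{v_{i,j}: j\in\mathcal M_k,\{i,j\}\in\mathcal E\}$; the scheme is feasible if, for all possible intermediate values, every machine $k$ can compute $\{v_{i,j}: i\in\mathcal R_k,\ j\notin\mathcal M_k,\ \{i,j\}\in\mathcal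 E\}$ from its local values and the messages of the other machines. Let $L_A(r,G)$ be the minimum of $\sum_k c_k/(n^2T)$ over all feasible schemes, and for a random graph $\mathcal G$ let $$L^*(r)=\inf_{A\in\mathcal A(r)}\mathbb E_{\mathcal G}[L_A(r,\mathcal G)].$$ In $\mathrm{SBM}(n_1,n_2,p,q)$, where $0<q<p\le1$, the vertices form two disjoint clusters of sizes $n_1,n_2$; independently over all unordered pairs $\{i,j\}$ (including $i=j$), the pair is an edge with probability $p$ if $i,j$ are in the same cluster and with probability $q$ otherwise. **Theorem.** Fix integers $1\le r\le K$. For each $n$ let $n_1+n_2=n$, $0<q<p\le1$ and $T\ge1$ be given (all depending on $n$), with $n_1=\Theta(n)$, $n_2=\Theta(n)$, $p=\omega(1/n^2)$ and $q=\omega(1/n^2)$, where $n\to\infty$ through the multiples of $K$. Then for $\mathrm{SBM}(n_1,n_2,p,q)$ $$\limsup_{n\to\infty}\ \frac{L^*(r)}{\dfrac{p n_1^2+p n_2^2+2q n_1n_2}{(n_1+n_2)^2}}\ \le\ \frac1r\Bigl(1-\frac rK\Bigr).$$ Moreover, for every $n\ge1$ divisible by $K$, $$\frac{L^*(r)}{q}\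 \ge\ \frac1r\Bigl(1-\frac rK\Bigr).$$ -/

import Mathlib

open Filter Topology

noncomputable section

namespace GraphMapReduce

/-- Binary words of length `T`. -/
abbrev Word (T : ℕ) : Type := Fin T → Bool

section Shuffle

variable {V : Type*} [Fintype V] [DecidableEq V] {K : ℕ}

/-- The intermediate values `v_{i,j}` of an undirected graph with edge set `E` (self-loops
allowed) are indexed by the ordered pairs `(i, j)` with `{i, j} ∈ E`: the value `v_{i,j}` is
Mapped from the file of `j` and is an input of the Reduce function of `i`. -/
abbrev ValueIdx (E : Finset (Sym2 V)) : Type _ := {e : V × V // s(e.1, e.2) ∈ E}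

/-- The intermediate values computed by a machine that stores the files of the vertices in `M`. -/
abbrev LocalIdx (E : Finset (Sym2 V)) (M : Finset V) : Type _ :=
  {e : ValueIdx E // e.1.2 ∈ M}

/-- The intermediate values which a machine with Mappers `M` and Reducers `R` must recover. -/
abbrev NeededIdx (E : Finset (Sym2 V)) (M R : Finset V) : Type _ :=
  {e : ValueIdx E // e.1.1 ∈ R ∧ e.1.2 ∉ M}

/-- A subgraph and computation allocation: machine `k` Maps the vertices in `M k` and
Reduces the vertices in `R k`. -/
structure Allocation (V : Type*) (K : ℕ) where
  M : Fin K → Finset V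
  R : Fin K → Finset V

/-- The allocations with computation load `r`: every vertex is Mapped somewhere,
`∑ₖ |M k| = r n`, and the sets `R k` partition the vertices into `K` parts of size `n / K`.
If `equal` holds, every machine must moreover Map the same number `r n / K` of vertices. -/
def allocations (V : Type*) [Fintype V] [DecidableEq V] (K r : ℕ) (equal : Prop) :
    Set (Allocation V K) :=
  {A | (∀ v, ∃ k, v ∈ A.M k) ∧
    ∑ k, (A.M k).card = r * Fintype.card V ∧
    (∀ k l, k ≠ l → Disjoint (A.R k) (A.R l)) ∧
    (∀ v, ∃ k, v ∈ A.R k) ∧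
    (∀ k, K * (A.R k).card = Fintype.card V) ∧
    (equal → ∀ k, K * (A.M k).card = r * Fintype.card V)}

/-- A feasible Shuffle coding scheme on the graph with edge set `E` for the allocation `A`
and intermediate values of `T` bits. Machine `k` multicasts a message of `len k` bits which is
a function of its local intermediate values, and recovers the values it needs from its local
values and the messages of the other machines, whatever the intermediate values are. -/
structure ShuffleScheme (E : Finset (Sym2 V)) (A : Allocation V K) (T : ℕ) where
  len : Fin K → ℕ
  encode : ∀ k, (LocalIdx E (A.M k) → Word T) → Word (len k)
  decode : ∀ k, (LocalIdx E (A.M k) → Word T) →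
    (∀ l : {l : Fin K // l ≠ k}, Word (len l)) → (NeededIdx E (A.M k) (A.R k) → Word T)
  correct : ∀ (v : ValueIdx E → Word T) (k : Fin K),
    decode k (fun e => v e.1) (fun l => encode l (fun e => v e.1)) = fun e => v e.1

/-- The minimum total number of bits of a feasible Shuffle coding scheme. -/
def minBits (E : Finset (Sym2 V)) (A : Allocation V K) (T : ℕ) : ℕ :=
  sInf {b | ∃ s : ShuffleScheme E A T, b = ∑ k, s.len k}

/-- The minimum normalized communication load `L_A(r, G)`. -/
def load (E : Finset (Sym2 V)) (A : Allocation V K) (T : ℕ) : ℝ :=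
  (minBits E A T : ℝ) / ((Fintype.card V : ℝ) ^ 2 * T)

end Shuffle

section RandomGraph

variable {V : Type*} [Fintype V] [DecidableEq V]

/-- The probability of the edge set `E` when every unordered pair `e` (of possibly equal
vertices) is an edge with probability `w e`, independently. -/
def graphProb (w : Sym2 V → ℝ) (E : Finset (Sym2 V)) : ℝ :=
  ∏ e, if e ∈ E then w e else 1 - w e

lemma sum_graphProb (w : Sym2 V → ℝ) : ∑ E, graphProb w E = 1 := by
  have h := Finset.prod_add w (fun e => 1 - w e) Finset.univ
  simp only [add_sub_cancel, Finset.prod_const_one, Finset.powerset_univ] at h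
  rw [h]
  refine Finset.sum_congr rfl fun E _ => ?_
  unfold graphProb
  rw [Finset.prod_ite]
  congr 1
  · congr 1
    ext; simp
  · congr 1
    ext; simp

/-- The expected load of the allocation `A` on a random graph with independent edges. -/
def avgLoad {K : ℕ} (w : Sym2 V → ℝ) (A : Allocation V K) (T : ℕ) : ℝ :=
  ∑ E, graphProb w E * load E A T

/-- The minimum average normalized communication load `L*(r)` of a random graph. -/
def optLoad (w : Sym2 V → ℝ) (K r T : ℕ) (equal : Prop) : ℝ :=
  sInf ((fun A => avgLoad w A T) '' allocations V K r equal)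

end RandomGraph

/-- The edge probabilities of the stochastic block model `SBM(n₁, n₂, p, q)`: the clusters are
the two summands of the vertex set `Fin n₁ ⊕ Fin n₂`; two (possibly equal) vertices of the same
cluster are joined with probability `p`, vertices of different clusters with probability `q`. -/
def sbmProb (n₁ n₂ : ℕ) (p q : ℝ) : Sym2 (Fin n₁ ⊕ Fin n₂) → ℝ :=
  Sym2.lift ⟨fun a b => if a.isLeft = b.isLeft then p else q, fun a b => by
    simp only [eq_comm]⟩

/-- `L*(r)` for `SBM(n₁, n₂, p, q)`, `K` machines and intermediate values of `T` bits. -/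
def sbmOptLoad (n₁ n₂ : ℕ) (p q : ℝ) (K r T : ℕ) (equal : Prop) : ℝ :=
  optLoad (sbmProb n₁ n₂ p q) K r T equal

/-- The limit `n → ∞` along the `n` divisible by `K`, for which sets of size `n / K` exist. -/
def atTopDvd (K : ℕ) : Filter ℕ := atTop ⊓ 𝓟 {n | K ∣ n}

end GraphMapReduce

end

noncomputable section

namespace GraphMapReduce

/-! ### Moments of edge counts under independent edges -/

section Expectation

variable {V : Type*} [Fintype V] [DecidableEq V]

/-! Achievability. Let every vertex be Mapped by exactly `r` machines. A value needed by `k` whose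
file has Mapper set `B` is served inside the group `U = B ∪ {k}`: the bits needed by `k` are spread
over the `r` other members of `U`, and each member sends parities in which every receiver knows all
terms but its own (`minBits_le_coded`). The cost of `U` is about `(r + 1) / r` times the largest
demand among its members. `cyclicAllocation` spreads Mapper sets and Reducers evenly over each
cluster, so each demand has mean at most about `D / (K * K.choose r)` with `D = p n₁² + p n₂² + 2 q
n₁ n₂` (`mean_groupPairs_le`). The variance of an edge count is at most twice its mean, so replacing
the largest demand by a mean bound costs `O(√D)`; this and the rounding to whole bits are negligible
because `D ≥ p n² / 2 → ∞`. Summing over the `K.choose (r + 1)` groups gives the constant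
(`choose_identity`).

Converse. For a fixed graph, induction on a set `S` of machines bounds from below the number of
message tuples that `S` can produce when everything known or needed outside `S` is fixed
(`demand_le_log_card_msgs`). It is the cut-set entropy argument with cardinalities in place of
entropies. For all machines together, a needed value with `b` Mappers costs at least `T / b` bits.
On average over the graph each pair is an edge with probability at least `q`, and convexity of `b ↦
(K - b) / b` under `∑ b = r n` concludes (`avgLoad_ge`). -/

lemma graphProb_nonneg {w : Sym2 V → ℝ} (h0 : ∀ e, 0 ≤ w e) (h1 : ∀ e, w e ≤ 1)
    (E : Finset (Sym2 V)) : 0 ≤ graphProb w E := by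
  refine Finset.prod_nonneg fun e _ => ?_
  split_ifs
  · exact h0 e
  · linarith [h1 e]

/-- Expand the product over all `e` of `w e + (1 - w e)` with the second summand deleted for `e ∈
A`: only the terms with `A ⊆ E` survive. -/
lemma sum_graphProb_subset (w : Sym2 V → ℝ) (A : Finset (Sym2 V)) :
    ∑ E, graphProb w E * (if A ⊆ E then 1 else 0) = ∏ e ∈ A, w e := by
  have h := Finset.prod_add w (fun e => if e ∈ A then 0 else 1 - w e) Finset.univ
  rw [Finset.powerset_univ] at h
  have h2 : ∏ e, (w e + if e ∈ A then 0 else 1 - w e) = ∏ e ∈ A, w e := by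
    rw [← Finset.prod_subset (Finset.subset_univ A)]
    · exact Finset.prod_congr rfl fun e he => by simp [he]
    · intro e _ he
      simp [he]
  rw [← h2, h]
  refine Finset.sum_congr rfl fun E _ => ?_
  have h3 : graphProb w E = (∏ e ∈ E, w e) * ∏ e ∈ Finset.univ \ E, (1 - w e) := by
    unfold graphProb
    rw [Finset.prod_ite]
    congr 1
    · congr 1
      ext; simp
    · congr 1
      ext; simp
  rw [h3, mul_assoc]
  congr 1
  split_ifs with hA
  · rw [mul_one]
    refine Finset.prod_congr rfl fun e he => ?_
    have : e ∉ A := fun h => (Finset.mem_sdiff.1 he).2 (hA h)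
    simp [this]
  · obtain ⟨e, heA, heE⟩ := Finset.not_subset.1 hA
    rw [mul_zero, eq_comm]
    exact Finset.prod_eq_zero (i := e) (by simp [heE]) (by simp [heA])

lemma sum_graphProb_mem (w : Sym2 V → ℝ) (e : Sym2 V) :
    ∑ E, graphProb w E * (if e ∈ E then 1 else 0) = w e := by
  simpa using sum_graphProb_subset w {e}

lemma sum_graphProb_mem_mem (w : Sym2 V → ℝ) {e f : Sym2 V} (hef : e ≠ f) :
    ∑ E, graphProb w E * ((if e ∈ E then 1 else 0) * (if f ∈ E then 1 else 0)) = w e * w f := by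
  have h := sum_graphProb_subset w {e, f}
  rw [Finset.prod_pair hef] at h
  rw [← h]
  refine Finset.sum_congr rfl fun E _ => ?_
  by_cases h1 : e ∈ E <;> by_cases h2 : f ∈ E <;> simp [Finset.insert_subset_iff, h1, h2]

/-- The number of the ordered pairs in `P` that are edges of `E`. -/
def edgeCount (P : Finset (V × V)) (E : Finset (Sym2 V)) : ℕ :=
  (P.filter fun x => s(x.1, x.2) ∈ E).card

omit [Fintype V] in
lemma edgeCount_eq_sum (P : Finset (V × V)) (E : Finset (Sym2 V)) :
    (edgeCount P E : ℝ) = ∑ x ∈ P, if s(x.1, x.2) ∈ E then 1 else 0 := by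
  simp [edgeCount]

lemma sum_graphProb_weighted (w : Sym2 V → ℝ) (c : V × V → ℝ) :
    ∑ E, graphProb w E * ∑ x, (if s(x.1, x.2) ∈ E then c x else 0)
      = ∑ x : V × V, w s(x.1, x.2) * c x := by
  simp_rw [Finset.mul_sum]
  rw [Finset.sum_comm]
  refine Finset.sum_congr rfl fun x _ => ?_
  rw [← sum_graphProb_mem w s(x.1, x.2), Finset.sum_mul]
  refine Finset.sum_congr rfl fun E _ => ?_
  split_ifs <;> simp

lemma sum_graphProb_edgeCount (w : Sym2 V → ℝ) (P : Finset (V × V)) :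
    ∑ E, graphProb w E * (edgeCount P E : ℝ) = ∑ x ∈ P, w s(x.1, x.2) := by
  simp_rw [edgeCount_eq_sum, Finset.mul_sum]
  rw [Finset.sum_comm]
  exact Finset.sum_congr rfl fun x _ => sum_graphProb_mem w _

/-- Distinct edges are uncorrelated, and an edge arises from at most two ordered pairs, `x` and
`x.swap`; hence the factor 2. -/
lemma variance_edgeCount_le {w : Sym2 V → ℝ} (h0 : ∀ e, 0 ≤ w e)
    (P : Finset (V × V)) :
    ∑ E, graphProb w E * ((edgeCount P E : ℝ) - ∑ x ∈ P, w s(x.1, x.2)) ^ 2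
      ≤ 2 * ∑ x ∈ P, w s(x.1, x.2) := by
  set μ := ∑ x ∈ P, w s(x.1, x.2) with hμ
  have hsq : ∑ E, graphProb w E * (edgeCount P E : ℝ) ^ 2 ≤ μ ^ 2 + 2 * μ := by
    have h1 : ∑ E, graphProb w E * (edgeCount P E : ℝ) ^ 2
        = ∑ x ∈ P, ∑ y ∈ P, ∑ E, graphProb w E *
          ((if s(x.1, x.2) ∈ E then 1 else 0) * (if s(y.1, y.2) ∈ E then 1 else 0)) := by
      simp_rw [edgeCount_eq_sum, sq, Finset.sum_mul_sum, Finset.mul_sum]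
      rw [Finset.sum_comm]
      refine Finset.sum_congr rfl fun x _ => ?_
      rw [Finset.sum_comm]
    have h2 : ∀ x ∈ P, ∀ y ∈ P, ∑ E, graphProb w E *
          ((if s(x.1, x.2) ∈ E then 1 else 0) * (if s(y.1, y.2) ∈ E then 1 else 0))
        ≤ w s(x.1, x.2) * w s(y.1, y.2)
          + w s(x.1, x.2) * (if s(y.1, y.2) = s(x.1, x.2) then 1 else 0) := by
      intro x _ y _
      by_cases hxy : s(y.1, y.2) = s(x.1, x.2)
      · rw [if_pos hxy, hxy]
        have : ∀ E : Finset (Sym2 V), ((if s(x.1, x.2) ∈ E then (1 : ℝ) else 0)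
            * (if s(x.1, x.2) ∈ E then 1 else 0)) = if s(x.1, x.2) ∈ E then 1 else 0 := by
          intro E; split_ifs <;> simp
        simp_rw [this, sum_graphProb_mem]
        nlinarith [h0 s(x.1, x.2)]
      · rw [if_neg hxy, sum_graphProb_mem_mem w (Ne.symm hxy)]
        simp
    have h3 : ∀ x ∈ P, ∑ y ∈ P, (if s(y.1, y.2) = s(x.1, x.2) then (1 : ℝ) else 0) ≤ 2 := by
      intro x _
      rw [Finset.sum_boole]
      have : P.filter (fun y => s(y.1, y.2) = s(x.1, x.2)) ⊆ {x, x.swap} := by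
        intro y hy
        have := (Finset.mem_filter.1 hy).2
        rw [Sym2.eq_iff] at this
        simp only [Finset.mem_insert, Finset.mem_singleton, Prod.ext_iff, Prod.fst_swap,
          Prod.snd_swap]
        exact this
      exact_mod_cast (Finset.card_le_card this).trans Finset.card_le_two
    rw [h1]
    calc _ ≤ ∑ x ∈ P, ∑ y ∈ P, (w s(x.1, x.2) * w s(y.1, y.2)
          + w s(x.1, x.2) * (if s(y.1, y.2) = s(x.1, x.2) then 1 else 0)) :=
          Finset.sum_le_sum fun x hx => Finset.sum_le_sum fun y hy => h2 x hx y hy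
      _ = μ ^ 2 + ∑ x ∈ P, w s(x.1, x.2) *
            ∑ y ∈ P, (if s(y.1, y.2) = s(x.1, x.2) then 1 else 0) := by
          simp_rw [Finset.sum_add_distrib, ← Finset.mul_sum]
          rw [← Finset.sum_mul, sq]
      _ ≤ μ ^ 2 + ∑ x ∈ P, w s(x.1, x.2) * 2 := by
          gcongr with x hx
          · exact h0 _
          · exact h3 x hx
      _ = μ ^ 2 + 2 * μ := by rw [← Finset.sum_mul, mul_comm]
  have hexp : ∑ E, graphProb w E * ((edgeCount P E : ℝ) - μ) ^ 2
      = ∑ E, graphProb w E * (edgeCount P E : ℝ) ^ 2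
        - 2 * μ * ∑ E, graphProb w E * (edgeCount P E : ℝ) + μ ^ 2 * ∑ E, graphProb w E := by
    rw [Finset.mul_sum (Finset.univ : Finset (Finset (Sym2 V))),
      Finset.mul_sum (Finset.univ : Finset (Finset (Sym2 V))), ← Finset.sum_sub_distrib, ← Finset.sum_add_distrib]
    exact Finset.sum_congr rfl fun E _ => by ring
  rw [hexp, sum_graphProb_edgeCount, sum_graphProb]
  nlinarith

lemma mean_abs_edgeCount_le {w : Sym2 V → ℝ} (h0 : ∀ e, 0 ≤ w e) (h1 : ∀ e, w e ≤ 1)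
    (P : Finset (V × V)) {m : ℝ} (hm : 0 < m) (hP : ∑ x ∈ P, w s(x.1, x.2) ≤ m) :
    ∑ E, graphProb w E * |(edgeCount P E : ℝ) - ∑ x ∈ P, w s(x.1, x.2)| ≤ 2 * √m := by
  set μ := ∑ x ∈ P, w s(x.1, x.2) with hμ
  have hs : 0 < √m := Real.sqrt_pos.2 hm
  have hss : √m * √m = m := Real.mul_self_sqrt hm.le
  -- AM-GM with weight `√m`, which turns the variance bound into a first-moment bound without
  -- Cauchy-Schwarz.
  have hpt : ∀ x : ℝ, |x| ≤ x ^ 2 / (2 * √m) + √m / 2 := by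
    intro x
    have h : 0 ≤ (|x| - √m) ^ 2 / (2 * √m) := by positivity
    have : (|x| - √m) ^ 2 / (2 * √m) = x ^ 2 / (2 * √m) + √m / 2 - |x| := by
      field_simp
      rw [sub_sq, sq_abs]; ring
    linarith
  calc _ ≤ ∑ E, graphProb w E * (((edgeCount P E : ℝ) - μ) ^ 2 / (2 * √m) + √m / 2) :=
        Finset.sum_le_sum fun E _ =>
          mul_le_mul_of_nonneg_left (hpt _) (graphProb_nonneg h0 h1 E)
    _ = (∑ E, graphProb w E * ((edgeCount P E : ℝ) - μ) ^ 2) / (2 * √m)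
          + (∑ E, graphProb w E) * (√m / 2) := by
        rw [Finset.sum_div, Finset.sum_mul, ← Finset.sum_add_distrib]
        exact Finset.sum_congr rfl fun E _ => by ring
    _ ≤ (2 * m) / (2 * √m) + 1 * (√m / 2) := by
        rw [sum_graphProb]
        gcongr
        exact (variance_edgeCount_le h0 P).trans (by linarith)
    _ = √m + √m / 2 := by
        rw [mul_div_mul_left _ _ two_ne_zero, Real.div_sqrt]; ring
    _ ≤ 2 * √m := by linarith

end Expectation

/-! ### Constructing feasible schemes -/

section Scheme

variable {V : Type*} [Fintype V] [DecidableEq V] {K : ℕ}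

/-- Messages that depend on local values only and that determine the needed values form a
feasible scheme. -/
lemma exists_shuffleScheme {E : Finset (Sym2 V)} {A : Allocation V K} {T : ℕ}
    {I : Fin K → Type*} [∀ k, Fintype (I k)]
    (enc : ∀ k, (ValueIdx E → Word T) → I k → Bool)
    (hloc : ∀ k v v', (∀ e : ValueIdx E, e.1.2 ∈ A.M k → v e = v' e) → enc k v = enc k v')
    (hdec : ∀ k v v', (∀ e : ValueIdx E, e.1.2 ∈ A.M k → v e = v' e) →
      (∀ l, l ≠ k → enc l v = enc l v') →
      ∀ e : ValueIdx E, e.1.1 ∈ A.R k → e.1.2 ∉ A.M k → v e = v' e) :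
    ∃ s : ShuffleScheme E A T, ∀ k, s.len k = Fintype.card (I k) := by
  classical
  let ext : ∀ k, (LocalIdx E (A.M k) → Word T) → ValueIdx E → Word T := fun k x e =>
    if h : e.1.2 ∈ A.M k then x ⟨e, h⟩ else fun _ => false
  let code : ∀ k, (LocalIdx E (A.M k) → Word T) → Word (Fintype.card (I k)) := fun k x i =>
    enc k (ext k x) ((Fintype.equivFin (I k)).symm i)
  have hcode : ∀ k (v : ValueIdx E → Word T),
      code k (fun e => v e.1) = fun i => enc k v ((Fintype.equivFin (I k)).symm i) := by
    intro k v
    funext i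
    have : enc k (ext k fun e => v e.1) = enc k v :=
      hloc k _ _ fun e he => by simp [ext, he]
    simp only [code, this]
  let Good : ∀ k, (LocalIdx E (A.M k) → Word T) →
      (∀ l : {l : Fin K // l ≠ k}, Word (Fintype.card (I l))) → (ValueIdx E → Word T) → Prop :=
    fun k x m v => (∀ e : LocalIdx E (A.M k), v e.1 = x e) ∧
      ∀ l : {l : Fin K // l ≠ k}, code l (fun e => v e.1) = m l
  -- The decoder picks any configuration consistent with what it sees; `hdec` says that all of these
  -- agree on the needed values.
  refine ⟨{ len := fun k => Fintype.card (I k)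
            encode := code
            decode := fun k x m => if h : ∃ v, Good k x m v then fun e => h.choose e.1
              else fun _ _ => false
            correct := ?_ }, fun _ => rfl⟩
  intro v k
  have hex : ∃ v', Good k (fun e => v e.1) (fun l => code l (fun e => v e.1)) v' :=
    ⟨v, fun _ => rfl, fun _ => rfl⟩
  rw [dif_pos hex]
  obtain ⟨hl, hm⟩ := hex.choose_spec
  funext e
  refine hdec k _ _ (fun e he => hl ⟨e, he⟩) (fun l hlk => ?_) e.1 e.2.1 e.2.2
  have := (hcode l _).symm.trans ((hm ⟨l, hlk⟩).trans (hcode l v))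
  funext i
  simpa using congrFun this (Fintype.equivFin (I l) i)

omit [Fintype V] [DecidableEq V] in
lemma minBits_le {E : Finset (Sym2 V)} {A : Allocation V K} {T : ℕ}
    (s : ShuffleScheme E A T) : minBits E A T ≤ ∑ k, s.len k :=
  Nat.sInf_le ⟨s, rfl⟩

/-- When every vertex is Mapped, it is feasible to multicast all local values. -/
lemma exists_minBits_eq {E : Finset (Sym2 V)} {A : Allocation V K} (T : ℕ)
    (hA : ∀ v, ∃ k, v ∈ A.M k) :
    ∃ s : ShuffleScheme E A T, minBits E A T = ∑ k, s.len k := by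
  obtain ⟨s, -⟩ := exists_shuffleScheme (E := E) (A := A) (T := T)
    (I := fun k => LocalIdx E (A.M k) × Fin T) (fun k v i => v i.1.1 i.2)
    (fun k v v' h => by
      funext i
      rw [h i.1.1 i.1.2])
    (fun k v v' _ h e _ he => by
      obtain ⟨l, hl⟩ := hA e.1.2
      have hlk : l ≠ k := fun h => he (h ▸ hl)
      funext t
      exact congrFun (h l hlk) (⟨e, hl⟩, t))
  -- Feasibility matters here: the infimum of an empty set would be the default value 0.
  exact Nat.sInf_mem (s := {b | ∃ s : ShuffleScheme E A T, b = ∑ k, s.len k}) ⟨_, s, rfl⟩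

end Scheme

/-! ### Lower bound: counting message tuples -/

section Converse

variable {V : Type*} [Fintype V] [DecidableEq V] {K : ℕ}

/-- The machines that Map the vertex `j`. -/
def mappers (A : Allocation V K) (j : V) : Finset (Fin K) :=
  Finset.univ.filter fun k => j ∈ A.M k

omit [Fintype V] in
lemma mem_mappers {A : Allocation V K} {j : V} {k : Fin K} :
    k ∈ mappers A j ↔ j ∈ A.M k := by simp [mappers]

/-- Two configurations agree on all values that are local to, or needed by, a machine outside
`S`. -/
def AgreeOutside {E : Finset (Sym2 V)} {T : ℕ} (A : Allocation V K) (S : Finset (Fin K))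
    (v v' : ValueIdx E → Word T) : Prop :=
  ∀ e : ValueIdx E, ∀ k ∉ S, (e.1.1 ∈ A.R k ∨ e.1.2 ∈ A.M k) → v e = v' e

/-- The values Reduced by `k` that are Mapped only at machines of `S` other than `k`. -/
def fresh (E : Finset (Sym2 V)) (A : Allocation V K) (S : Finset (Fin K)) (k : Fin K) :
    Finset (ValueIdx E) :=
  Finset.univ.filter fun e => e.1.1 ∈ A.R k ∧ mappers A e.1.2 ⊆ S.erase k

/-- The lower bound on the number of `T`-bit words that the machines of `S` must send. -/
def demand (E : Finset (Sym2 V)) (A : Allocation V K) (S : Finset (Fin K)) : ℝ :=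
  ∑ k ∈ S, ∑ e : ValueIdx E,
    if e.1.1 ∈ A.R k ∧ mappers A e.1.2 ⊆ S.erase k then 1 / ((mappers A e.1.2).card : ℝ) else 0

/-- Take a value Reduced by `l ∈ S` with Mapper set `B ⊆ S.erase l`. On the right it counts 1 as
fresh, and `1 / |B|` for each of the `|S| - 1 - |B|` machines `k` of `S` outside `B ∪ {l}`. The
total is `(|S| - 1) / |B|`. -/
lemma demand_recursion (E : Finset (Sym2 V)) {A : Allocation V K}
    (hM : ∀ v, ∃ k, v ∈ A.M k) (S : Finset (Fin K)) :
    ((S.card : ℝ) - 1) * demand E A S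
      = ∑ k ∈ S, (((fresh E A S k).card : ℝ) + demand E A (S.erase k)) := by
  have hswap : ∑ k ∈ S, demand E A (S.erase k) = ∑ l ∈ S, ∑ e : ValueIdx E, ∑ k ∈ S.erase l,
      if e.1.1 ∈ A.R l ∧ mappers A e.1.2 ⊆ (S.erase k).erase l
        then 1 / ((mappers A e.1.2).card : ℝ) else 0 := by
    unfold demand
    rw [Finset.sum_comm' (t' := S) (s' := fun l => S.erase l)
      (by intro x y; simp only [Finset.mem_erase]; tauto)]
    exact Finset.sum_congr rfl fun l _ => Finset.sum_comm
  rw [Finset.sum_add_distrib, hswap, ← Finset.sum_add_distrib, demand, Finset.mul_sum]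
  refine Finset.sum_congr rfl fun l hl => ?_
  rw [fresh, Finset.card_filter, Nat.cast_sum, ← Finset.sum_add_distrib, Finset.mul_sum]
  refine Finset.sum_congr rfl fun e _ => ?_
  by_cases h : e.1.1 ∈ A.R l ∧ mappers A e.1.2 ⊆ S.erase l
  · obtain ⟨k₀, hk₀⟩ := hM e.1.2
    have hpos : 0 < (mappers A e.1.2).card := Finset.card_pos.2 ⟨k₀, mem_mappers.2 hk₀⟩
    have hpos' : ((mappers A e.1.2).card : ℝ) ≠ 0 := by positivity
    have hsum : ∑ k ∈ S.erase l, (if e.1.1 ∈ A.R l ∧ mappers A e.1.2 ⊆ (S.erase k).erase l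
        then 1 / ((mappers A e.1.2).card : ℝ) else 0)
        = ((S.card : ℝ) - 1 - (mappers A e.1.2).card) * (1 / ((mappers A e.1.2).card : ℝ)) := by
      rw [← Finset.sum_filter, Finset.sum_const, nsmul_eq_mul]
      congr 1
      have hset : (S.erase l).filter
          (fun k => e.1.1 ∈ A.R l ∧ mappers A e.1.2 ⊆ (S.erase k).erase l)
          = S.erase l \ mappers A e.1.2 := by
        ext k
        simp only [Finset.mem_filter, Finset.mem_sdiff, h.1, true_and]
        refine and_congr_right fun _ => ?_
        rw [Finset.erase_right_comm, Finset.subset_erase]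
        simp [h.2]
      have hc := Finset.card_sdiff_add_card_eq_card h.2
      have hc2 := Finset.card_erase_add_one hl
      rw [hset]
      have h1 : (((S.erase l \ mappers A e.1.2).card : ℕ) : ℝ) + (mappers A e.1.2).card
          = (S.erase l).card := by exact_mod_cast hc
      have h2 : ((S.erase l).card : ℝ) + 1 = S.card := by exact_mod_cast hc2
      linarith
    rw [hsum, if_pos h, if_pos h]
    field_simp
    push_cast
    ring
  · rw [if_neg h, if_neg h]
    simp only [mul_zero, Nat.cast_zero, zero_add]
    rw [eq_comm]
    refine Finset.sum_eq_zero fun k _ => if_neg fun h' => h ⟨h'.1, h'.2.trans ?_⟩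
    exact Finset.erase_subset_erase l (Finset.erase_subset k S)

variable {E : Finset (Sym2 V)} {A : Allocation V K} {T : ℕ}

/-- The messages of the machines in `S`; the other messages are blanked. -/
def msg (s : ShuffleScheme E A T) (S : Finset (Fin K)) (v : ValueIdx E → Word T) :
    ∀ k, Word (s.len k) :=
  fun k => if k ∈ S then s.encode k (fun e => v e.1) else fun _ => false

open Classical in
/-- The possible messages of the machines in `S`, given what the other machines know. -/
def msgs (s : ShuffleScheme E A T) (S : Finset (Fin K)) (v₀ : ValueIdx E → Word T) :
    Finset (∀ k, Word (s.len k)) :=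
  (Finset.univ.filter fun v => AgreeOutside A S v v₀).image (msg s S)

omit [Fintype V] [DecidableEq V] in
lemma encode_congr (s : ShuffleScheme E A T) {k : Fin K} {v v' : ValueIdx E → Word T}
    (h : ∀ e : ValueIdx E, e.1.2 ∈ A.M k → v e = v' e) :
    s.encode k (fun e => v e.1) = s.encode k (fun e => v' e.1) := by
  congr 1
  funext e
  exact h e.1 e.2

omit [Fintype V] [DecidableEq V] in
lemma decode_congr (s : ShuffleScheme E A T) {k : Fin K} {v v' : ValueIdx E → Word T}
    (h : ∀ e : ValueIdx E, e.1.2 ∈ A.M k → v e = v' e)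
    (hm : ∀ l, l ≠ k → s.encode l (fun e => v e.1) = s.encode l (fun e => v' e.1))
    (e : ValueIdx E) (h1 : e.1.1 ∈ A.R k) (h2 : e.1.2 ∉ A.M k) : v e = v' e := by
  have e1 := s.correct v k
  have e2 := s.correct v' k
  have hx : (fun e : LocalIdx E (A.M k) => v e.1) = fun e => v' e.1 :=
    funext fun e => h e.1 e.2
  have hy : (fun l : {l : Fin K // l ≠ k} => s.encode l (fun e => v e.1))
      = fun l : {l : Fin K // l ≠ k} => s.encode l (fun e => v' e.1) :=
    funext fun l => hm l.1 l.2
  rw [hx, hy, e2] at e1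
  exact (congrFun e1 ⟨e, h1, h2⟩).symm

-- With the message of `k` fixed, the fresh values of `k` can still be chosen freely, since `k` does
-- not Map them. As `k` decodes them, different choices lead to disjoint sets of message tuples,
-- each at least as large as a `msgs` set of `S.erase k`.
open Classical in
lemma card_fiber_msgs_ge (s : ShuffleScheme E A T)
    (hR : ∀ k l, k ≠ l → Disjoint (A.R k) (A.R l))
    {S : Finset (Fin K)} {k : Fin K} (hk : k ∈ S) {v₀ v₁ : ValueIdx E → Word T}
    (h₁ : AgreeOutside A S v₁ v₀) {b : ℝ}
    (hb : ∀ v, b ≤ ((msgs s (S.erase k) v).card : ℝ)) :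
    ((2 : ℝ) ^ T) ^ (fresh E A S k).card * b
      ≤ (((msgs s S v₀).filter fun x => x k = s.encode k (fun e => v₁ e.1)).card : ℝ) := by
  -- `ov z` is `v₁` with its fresh values overwritten by `z`; `F z` collects the tuples compatible
  -- with it.
  let ov : (fresh E A S k → Word T) → ValueIdx E → Word T := fun z e =>
    if h : e ∈ fresh E A S k then z ⟨e, h⟩ else v₁ e
  let F : (fresh E A S k → Word T) → Finset (∀ k, Word (s.len k)) := fun z =>
    (Finset.univ.filter fun v => AgreeOutside A (S.erase k) v (ov z)).image (msg s S)
  have hkk : k ∉ S.erase k := by simp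
  have hnot : ∀ e : ValueIdx E, ∀ l ∉ S, e.1.1 ∈ A.R l ∨ e.1.2 ∈ A.M l →
      e ∉ fresh E A S k := by
    intro e l hl hel hef
    obtain ⟨h1, h2⟩ := (Finset.mem_filter.1 hef).2
    rcases hel with h | h
    · have hlk : k ≠ l := fun h => hl (h ▸ hk)
      exact Finset.disjoint_left.1 (hR k l hlk) h1 h
    · exact hl (Finset.mem_of_mem_erase (h2 (mem_mappers.2 h)))
  have hnotk : ∀ e : ValueIdx E, e.1.2 ∈ A.M k → e ∉ fresh E A S k := by
    intro e he hef
    exact hkk ((Finset.mem_filter.1 hef).2.2 (mem_mappers.2 he))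
  have hloc : ∀ z v, AgreeOutside A (S.erase k) v (ov z) →
      ∀ e : ValueIdx E, e.1.2 ∈ A.M k → v e = v₁ e := by
    intro z v hv e he
    rw [hv e k hkk (Or.inr he)]
    simp only [ov, dif_neg (hnotk e he)]
  have hout : ∀ z v, AgreeOutside A (S.erase k) v (ov z) → AgreeOutside A S v v₁ := by
    intro z v hv e l hl hel
    rw [hv e l (fun h => hl (Finset.mem_of_mem_erase h)) hel]
    simp only [ov, dif_neg (hnot e l hl hel)]
  have hFsub : ∀ z, F z ⊆
      (msgs s S v₀).filter fun x => x k = s.encode k (fun e => v₁ e.1) := by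
    intro z x hx
    obtain ⟨v, hv, rfl⟩ := Finset.mem_image.1 hx
    have hv := (Finset.mem_filter.1 hv).2
    refine Finset.mem_filter.2 ⟨Finset.mem_image_of_mem _ (Finset.mem_filter.2
      ⟨Finset.mem_univ _, fun e l hl hel => ?_⟩), ?_⟩
    · rw [hout z v hv e l hl hel, h₁ e l hl hel]
    · simp only [msg, if_pos hk]
      exact encode_congr s (hloc z v hv)
  have hFcard : ∀ z, b ≤ ((F z).card : ℝ) := by
    intro z
    refine (hb (ov z)).trans ?_
    -- Blanking the coordinate `k` maps `F z` onto this set.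
    have : msgs s (S.erase k) (ov z)
        = (F z).image (fun x l => if l ∈ S.erase k then x l else fun _ => false) := by
      rw [Finset.image_image, msgs]
      congr 1
      funext v l
      by_cases hl : l ∈ S.erase k
      · simp only [msg, Function.comp, if_pos hl, if_pos (Finset.mem_of_mem_erase hl)]
      · simp only [msg, Function.comp, if_neg hl]
    rw [this]
    exact_mod_cast Finset.card_image_le
  have hdisj : ∀ z ∈ Finset.univ, ∀ z' ∈ Finset.univ, z ≠ z' → Disjoint (F z) (F z') := by
    intro z _ z' _ hzz
    rw [Finset.disjoint_left]
    intro x hx hx'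
    obtain ⟨v, hv, rfl⟩ := Finset.mem_image.1 hx
    obtain ⟨v', hv', hvv⟩ := Finset.mem_image.1 hx'
    have hv := (Finset.mem_filter.1 hv).2
    have hv' := (Finset.mem_filter.1 hv').2
    have hagree : ∀ e : ValueIdx E, e.1.2 ∈ A.M k → v e = v' e := fun e he => by
      rw [hloc z v hv e he, hloc z' v' hv' e he]
    -- Inside `S` the messages agree as the tuples coincide; outside `S` they agree because their
    -- local values are those of `v₁`.
    have hmsg : ∀ l, l ≠ k →
        s.encode l (fun e => v e.1) = s.encode l (fun e => v' e.1) := by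
      intro l _
      by_cases hl : l ∈ S
      · have := congrFun hvv l
        simp only [msg, if_pos hl] at this
        exact this.symm
      · refine encode_congr s fun e he => ?_
        rw [hout z v hv e l hl (Or.inr he), hout z' v' hv' e l hl (Or.inr he)]
    refine hzz (funext fun e => ?_)
    obtain ⟨he1, he2⟩ := (Finset.mem_filter.1 e.2).2
    have hd := decode_congr s hagree hmsg e.1 he1 (fun h => hkk (he2 (mem_mappers.2 h)))
    rw [hv e.1 k hkk (Or.inl he1), hv' e.1 k hkk (Or.inl he1)] at hd
    simpa [ov] using hd
  have hle := Finset.card_le_card (Finset.biUnion_subset.2 fun z (_ : z ∈ Finset.univ) => hFsub z)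
  rw [Finset.card_biUnion hdisj] at hle
  calc ((2 : ℝ) ^ T) ^ (fresh E A S k).card * b
      = ∑ _z : fresh E A S k → Word T, b := by
        simp [Word]
    _ ≤ ∑ z, ((F z).card : ℝ) := Finset.sum_le_sum fun z _ => hFcard z
    _ ≤ _ := by exact_mod_cast hle

open Classical in
lemma msgs_nonempty (s : ShuffleScheme E A T) (S : Finset (Fin K)) (v₀ : ValueIdx E → Word T) :
    (msgs s S v₀).Nonempty :=
  ⟨msg s S v₀, Finset.mem_image_of_mem _ (Finset.mem_filter.2
    ⟨Finset.mem_univ _, fun _ _ _ _ => rfl⟩)⟩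

open Classical in
lemma card_msgs_ge (s : ShuffleScheme E A T)
    (hR : ∀ k l, k ≠ l → Disjoint (A.R k) (A.R l))
    {S : Finset (Fin K)} {k : Fin K} (hk : k ∈ S) (v₀ : ValueIdx E → Word T) {b : ℝ}
    (hb : ∀ v, b ≤ ((msgs s (S.erase k) v).card : ℝ)) :
    (((msgs s S v₀).image fun x => x k).card : ℝ) * (((2 : ℝ) ^ T) ^ (fresh E A S k).card * b)
      ≤ ((msgs s S v₀).card : ℝ) := by
  rw [Finset.card_eq_sum_card_image (fun x => x k) (msgs s S v₀), ← nsmul_eq_mul,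
    Nat.cast_sum]
  refine Finset.card_nsmul_le_sum _ _ _ fun y hy => ?_
  obtain ⟨x, hx, rfl⟩ := Finset.mem_image.1 hy
  obtain ⟨v, hv, rfl⟩ := Finset.mem_image.1 hx
  have h := card_fiber_msgs_ge s hR hk (Finset.mem_filter.1 hv).2 hb
  simpa only [msg, if_pos hk] using h

-- A set of tuples lies in the product of its projections (subadditivity of entropy); the blanked
-- coordinates contribute a factor 1.
open Classical in
lemma log_card_msgs_le (s : ShuffleScheme E A T) (S : Finset (Fin K))
    (v₀ : ValueIdx E → Word T) :
    Real.logb 2 (msgs s S v₀).card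
      ≤ ∑ k ∈ S, Real.logb 2 ((msgs s S v₀).image fun x => x k).card := by
  have hne : ∀ k, 0 < ((msgs s S v₀).image fun x => x k).card := fun k =>
    Finset.card_pos.2 ((msgs_nonempty s S v₀).image _)
  have hsub : msgs s S v₀ ⊆ Fintype.piFinset fun k => (msgs s S v₀).image fun x => x k := by
    intro x hx
    rw [Fintype.mem_piFinset]
    exact fun k => Finset.mem_image_of_mem _ hx
  have hcard := Finset.card_le_card hsub
  rw [Fintype.card_piFinset] at hcard
  have h1 : ∀ k ∉ S, ((msgs s S v₀).image fun x => x k).card = 1 := by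
    intro k hk
    refine le_antisymm ?_ (hne k)
    rw [Finset.card_le_one]
    intro a ha b hb
    obtain ⟨x, hx, rfl⟩ := Finset.mem_image.1 ha
    obtain ⟨v, -, rfl⟩ := Finset.mem_image.1 hx
    obtain ⟨y, hy, rfl⟩ := Finset.mem_image.1 hb
    obtain ⟨v', -, rfl⟩ := Finset.mem_image.1 hy
    simp [msg, hk]
  rw [← Finset.prod_subset (Finset.subset_univ S) fun k _ hk => h1 k hk] at hcard
  rw [← Real.logb_prod _ _ fun k _ => by exact_mod_cast (hne k).ne']
  refine Real.logb_le_logb_of_le one_lt_two ?_ (by exact_mod_cast hcard)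
  exact_mod_cast Finset.card_pos.2 (msgs_nonempty s S v₀)

/-- Write `H S` for the logarithm on the right. Fibering over the message of `k` bounds `H S` below
by the logarithm of the number of messages of `k`, plus `T` times the fresh count and `demand` of
`S.erase k`. Summed over `k ∈ S`, the message terms give at least `H S`, which leaves a factor `|S|
- 1` on both sides by `demand_recursion`. -/
lemma demand_le_log_card_msgs (s : ShuffleScheme E A T)
    (hM : ∀ v, ∃ k, v ∈ A.M k) (hR : ∀ k l, k ≠ l → Disjoint (A.R k) (A.R l))
    (S : Finset (Fin K)) :
    ∀ v₀, T * demand E A S ≤ Real.logb 2 (msgs s S v₀).card := by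
  classical
  induction S using Finset.strongInduction with
  | H S ih =>
    intro v₀
    have hpos : ∀ S' v, (0 : ℝ) < (msgs s S' v).card := fun S' v => by
      exact_mod_cast Finset.card_pos.2 (msgs_nonempty s S' v)
    have hL0 : 0 ≤ Real.logb 2 (msgs s S v₀).card :=
      Real.logb_nonneg one_lt_two (by exact_mod_cast Finset.card_pos.2 (msgs_nonempty s S v₀))
    have hstep : ∀ k ∈ S, Real.logb 2 ((msgs s S v₀).image fun x => x k).card
        + T * (((fresh E A S k).card : ℝ) + demand E A (S.erase k))
        ≤ Real.logb 2 (msgs s S v₀).card := by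
      intro k hk
      have hb : ∀ v, (2 : ℝ) ^ (T * demand E A (S.erase k))
          ≤ ((msgs s (S.erase k) v).card : ℝ) := fun v => by
        rw [← Real.le_logb_iff_rpow_le one_lt_two (hpos _ _)]
        exact ih _ (Finset.erase_ssubset hk) v
      have h := card_msgs_ge s hR hk v₀ hb
      have hi : (0 : ℝ) < ((msgs s S v₀).image fun x => x k).card := by
        exact_mod_cast Finset.card_pos.2 ((msgs_nonempty s S v₀).image _)
      have h2 := Real.logb_le_logb_of_le one_lt_two (by positivity) h
      rw [Real.logb_mul hi.ne' (by positivity), Real.logb_mul (by positivity) (by positivity),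
        Real.logb_rpow two_pos (by norm_num), ← pow_mul, Real.logb_pow,
        Real.logb_self_eq_one one_lt_two] at h2
      push_cast at h2
      linarith
    have hsum := Finset.sum_le_sum hstep
    rw [Finset.sum_add_distrib, ← Finset.mul_sum, ← demand_recursion E hM S,
      Finset.sum_const, nsmul_eq_mul] at hsum
    have hlog := log_card_msgs_le s S v₀
    have hmain : ((S.card : ℝ) - 1) * (T * demand E A S)
        ≤ ((S.card : ℝ) - 1) * Real.logb 2 (msgs s S v₀).card := by linarith
    rcases lt_or_ge 1 S.card with h1 | h1
    · have : (0 : ℝ) < (S.card : ℝ) - 1 := by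
        have : (1 : ℝ) < S.card := by exact_mod_cast h1
        linarith
      exact le_of_mul_le_mul_left hmain this
    -- For `|S| ≤ 1` the factor `|S| - 1` gives nothing, but a counted value would have no Mapper.
    · have hz : demand E A S = 0 := by
        refine Finset.sum_eq_zero fun k hk => Finset.sum_eq_zero fun e _ => if_neg ?_
        rintro ⟨-, h⟩
        obtain ⟨l, hl⟩ := hM e.1.2
        have hlS := h (mem_mappers.2 hl)
        have := Finset.card_le_one.1 h1 l (Finset.mem_of_mem_erase hlS) k hk
        exact Finset.ne_of_mem_erase hlS this
      simpa [hz] using hL0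

/-- The cut-set type converse for one graph. -/
lemma demand_le_minBits (E : Finset (Sym2 V)) {A : Allocation V K} (T : ℕ)
    (hM : ∀ v, ∃ k, v ∈ A.M k) (hR : ∀ k l, k ≠ l → Disjoint (A.R k) (A.R l)) :
    T * demand E A Finset.univ ≤ minBits E A T := by
  obtain ⟨s, hs⟩ := exists_minBits_eq (E := E) T hM
  rw [hs]
  refine (demand_le_log_card_msgs s hM hR Finset.univ (fun _ _ => false)).trans ?_
  have hcard := Finset.card_le_univ (msgs s Finset.univ (fun _ _ => false))
  have h2 : Fintype.card (∀ k, Word (s.len k)) = 2 ^ ∑ k, s.len k := by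
    simp [Word, Fintype.card_pi, Finset.prod_pow_eq_pow_sum]
  rw [h2] at hcard
  rw [Real.logb_le_iff_le_rpow one_lt_two
    (by exact_mod_cast Finset.card_pos.2 (msgs_nonempty s _ _)), Real.rpow_natCast]
  exact_mod_cast hcard

lemma demand_univ (E : Finset (Sym2 V)) (A : Allocation V K) :
    demand E A Finset.univ = ∑ x : V × V, if s(x.1, x.2) ∈ E then
      (∑ k, if x.1 ∈ A.R k ∧ x.2 ∉ A.M k then 1 / ((mappers A x.2).card : ℝ) else 0) else 0 := by
  rw [← Finset.sum_filter, demand, Finset.sum_comm,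
    Finset.sum_subtype (Finset.univ.filter fun x : V × V => s(x.1, x.2) ∈ E)
      (p := fun x => s(x.1, x.2) ∈ E) (by simp)]
  refine Finset.sum_congr rfl fun e _ => Finset.sum_congr rfl fun k _ => ?_
  simp only [Finset.subset_erase, Finset.subset_univ, true_and, mem_mappers]

lemma avgLoad_ge {w : Sym2 V → ℝ} {q : ℝ} (hq : 0 ≤ q) (hqw : ∀ e, q ≤ w e)
    (hw : ∀ e, w e ≤ 1) {r T : ℕ} (hr : 1 ≤ r) (hK : 1 ≤ K) (hT : 1 ≤ T) {equal : Prop}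
    (hV : 0 < Fintype.card V)
    {A : Allocation V K} (hA : A ∈ allocations V K r equal) :
    q * (1 / (r : ℝ) * (1 - (r : ℝ) / (K : ℝ))) ≤ avgLoad w A T := by
  obtain ⟨hM, hMsum, hR, -, hRcard, -⟩ := hA
  set n : ℝ := (Fintype.card V : ℝ) with hn
  have hn0 : 0 < n := Nat.cast_pos.2 hV
  have hK0 : (0 : ℝ) < K := by exact_mod_cast hK
  have hr0 : (0 : ℝ) < r := by exact_mod_cast hr
  have hT0 : (0 : ℝ) < T := by exact_mod_cast hT
  let b : V → ℝ := fun j => (mappers A j).card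
  have hb : ∀ j, 0 < b j := fun j => by
    obtain ⟨k, hk⟩ := hM j
    exact Nat.cast_pos.2 (Finset.card_pos.2 ⟨k, mem_mappers.2 hk⟩)
  have hbsum : ∑ j, b j = r * n := by
    have : ∑ j, (mappers A j).card = ∑ k, (A.M k).card := by
      simp_rw [mappers, Finset.card_filter]
      rw [Finset.sum_comm]
      exact Finset.sum_congr rfl fun k _ => by simp
    rw [hMsum] at this
    simp only [b, hn]
    exact_mod_cast this
  let c : V × V → ℝ := fun x =>
    ∑ k, if x.1 ∈ A.R k ∧ x.2 ∉ A.M k then 1 / ((mappers A x.2).card : ℝ) else 0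
  have hc0 : ∀ x, 0 ≤ c x := fun x => Finset.sum_nonneg fun k _ => by
    split_ifs <;> positivity
  have hcsum : ∑ x, c x = ∑ j, (n / K) * ((K - b j) / b j) := by
    rw [Fintype.sum_prod_type_right]
    refine Finset.sum_congr rfl fun j _ => ?_
    simp only [c]
    rw [Finset.sum_comm]
    have h1 : ∀ k, ∑ i, (if i ∈ A.R k ∧ j ∉ A.M k then 1 / ((mappers A j).card : ℝ) else 0)
        = (n / K) * (if k ∈ (mappers A j)ᶜ then 1 / b j else 0) := by
      intro k
      have hRk : ((A.R k).card : ℝ) = n / K := by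
        rw [eq_div_iff hK0.ne', mul_comm, hn, ← hRcard k, Nat.cast_mul]
      by_cases hj : j ∈ A.M k
      · simp [hj, mem_mappers]
      · simp [hj, mem_mappers, hRk, b]
    simp_rw [h1]
    rw [← Finset.mul_sum, Finset.sum_ite_mem, Finset.univ_inter, Finset.sum_const, nsmul_eq_mul,
      Finset.card_compl, Nat.cast_sub (Finset.card_le_univ _), Fintype.card_fin]
    simp only [b]
    ring
  have hconv : n * (K / r - 1) ≤ ∑ j, (K - b j) / b j := by
    -- Tangent line of `b ↦ K / b - 1` at `b = r`; its linear part sums to zero because `∑ b j = r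
    -- n`.
    have hpt : ∀ j, (K : ℝ) / r - 1 - K / r ^ 2 * (b j - r) ≤ (K - b j) / b j := by
      intro j
      have hbj := hb j
      have : (K - b j) / b j - ((K : ℝ) / r - 1 - K / r ^ 2 * (b j - r))
          = K * (b j - r) ^ 2 / (b j * r ^ 2) := by
        field_simp
        ring
      have h2 : 0 ≤ K * (b j - r) ^ 2 / (b j * r ^ 2) := by positivity
      linarith
    have := Finset.sum_le_sum fun j (_ : j ∈ Finset.univ) => hpt j
    rw [Finset.sum_sub_distrib, ← Finset.mul_sum, Finset.sum_sub_distrib,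
      Finset.sum_sub_distrib, hbsum] at this
    simp only [Finset.sum_const, Finset.card_univ, nsmul_eq_mul] at this
    rw [← hn] at this
    linarith [this, mul_comm (r : ℝ) n]
  have hmean : ∑ E, graphProb w E * demand E A Finset.univ = ∑ x : V × V, w s(x.1, x.2) * c x := by
    simp_rw [demand_univ]
    exact sum_graphProb_weighted w c
  have hlow : q * ((n / K) * (n * (K / r - 1))) ≤ ∑ E, graphProb w E * demand E A Finset.univ := by
    rw [hmean]
    calc q * ((n / K) * (n * (K / r - 1))) ≤ q * ((n / K) * ∑ j, (K - b j) / b j) := by gcongr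
      _ = ∑ x, q * c x := by rw [← Finset.mul_sum, hcsum, Finset.mul_sum]
      _ ≤ _ := Finset.sum_le_sum fun x _ => mul_le_mul_of_nonneg_right (hqw _) (hc0 x)
  calc q * (1 / (r : ℝ) * (1 - (r : ℝ) / (K : ℝ)))
      = q * ((n / K) * (n * (K / r - 1))) / n ^ 2 := by field_simp
    _ ≤ (∑ E, graphProb w E * demand E A Finset.univ) / n ^ 2 := by gcongr
    _ = ∑ E, graphProb w E * (T * demand E A Finset.univ / (n ^ 2 * T)) := by
        rw [Finset.sum_div]
        exact Finset.sum_congr rfl fun E _ => by field_simp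
    _ ≤ avgLoad w A T := by
        refine Finset.sum_le_sum fun E _ => ?_
        refine mul_le_mul_of_nonneg_left ?_ (graphProb_nonneg (fun e => hq.trans (hqw e)) hw E)
        unfold load
        gcongr
        exact demand_le_minBits E T hM hR

end Converse

/-! ### Upper bound: coded multicast in groups of `r + 1` machines -/

section Coding

variable {V : Type*} [Fintype V] [DecidableEq V] {K : ℕ}

/-- The ordered pairs whose values, in the coded multicast within the group `U` of machines, are
needed by `k` and known exactly to the other machines. -/
def groupPairs (A : Allocation V K) (U : Finset (Fin K)) (k : Fin K) : Finset (V × V) :=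
  Finset.univ.filter fun x => x.1 ∈ A.R k ∧ mappers A x.2 = U.erase k

lemma zmod_two_ext {a b : ZMod 2} (h : decide (a = 1) = decide (b = 1)) : a = b := by
  revert a b
  decide

/-- The coded multicast within every group of `r + 1` machines: each machine of the group `U`
sends `c U` bits. -/
lemma minBits_le_coded (E : Finset (Sym2 V)) (A : Allocation V K) (T r : ℕ)
    (hA : ∀ j, (mappers A j).card = r) (c : Finset (Fin K) → ℕ)
    (hc : ∀ U k, U.card = r + 1 → k ∈ U → edgeCount (groupPairs A U k) E * T ≤ r * c U) :
    minBits E A T ≤ ∑ U ∈ Finset.univ.powersetCard (r + 1), (r + 1) * c U := by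
  classical
  let Z : Finset (Fin K) → Fin K → Type _ := fun U k =>
    {e : ValueIdx E // e.1 ∈ groupPairs A U k}
  have hZ : ∀ U k, Fintype.card (Z U k) = edgeCount (groupPairs A U k) E := by
    intro U k
    rw [edgeCount, ← Fintype.card_coe]
    refine Fintype.card_congr ⟨fun z => ⟨z.1.1, Finset.mem_filter.2 ⟨z.2, z.1.2⟩⟩,
      fun x => ⟨⟨x.1, (Finset.mem_filter.1 x.2).2⟩, (Finset.mem_filter.1 x.2).1⟩,
      fun _ => rfl, fun _ => rfl⟩
  -- `φ U k` places each bit needed by `k` in its own slot `(l, i)`: it is carried by the `i`-th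
  -- parity of machine `l`. The `r * c U` slots suffice by `hc`.
  have hφ : ∀ U k, ∃ φ : Z U k × Fin T → Fin K × ℕ, U.card = r + 1 → k ∈ U →
      Function.Injective φ ∧ ∀ z, (φ z).1 ∈ U.erase k ∧ (φ z).2 < c U := by
    intro U k
    by_cases h : U.card = r + 1 ∧ k ∈ U
    · have hcard : Fintype.card (Z U k × Fin T) ≤ Fintype.card (U.erase k × Fin (c U)) := by
        rw [Fintype.card_prod, Fintype.card_prod, hZ, Fintype.card_fin, Fintype.card_fin,
          Fintype.card_coe, Finset.card_erase_of_mem h.2, h.1]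
        exact hc U k h.1 h.2
      obtain ⟨f⟩ := Function.Embedding.nonempty_of_card_le hcard
      refine ⟨fun z => ((f z).1, (f z).2), fun _ _ => ⟨fun z z' hz => f.injective ?_,
        fun z => ⟨(f z).1.2, (f z).2.2⟩⟩⟩
      have h1 := (Prod.ext_iff.1 hz).1
      have h2 := (Prod.ext_iff.1 hz).2
      exact Prod.ext (Subtype.ext h1) (Fin.ext h2)
    · exact ⟨fun _ => (k, 0), fun h1 h2 => (h ⟨h1, h2⟩).elim⟩
  choose φ hφ using hφ
  -- Unused slots carry `false`, hence add nothing to a parity.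
  let g : ∀ U k, (ValueIdx E → Word T) → Fin K × ℕ → Bool := fun U k v =>
    Function.extend (φ U k) (fun z => v z.1.1 z.2) (fun _ => false)
  have hg : ∀ U k v v', (∀ z : Z U k, v z.1 = v' z.1) → g U k v = g U k v' := by
    intro U k v v' h
    simp only [g, h]
  let I : Fin K → Type := fun l =>
    Σ U : {U : Finset (Fin K) // U ∈ Finset.univ.powersetCard (r + 1) ∧ l ∈ U}, Fin (c U)
  let enc : ∀ l, (ValueIdx E → Word T) → I l → Bool := fun l v i =>
    decide (∑ k ∈ i.1.1.erase l, (if g i.1.1 k v (l, i.2) then (1 : ZMod 2) else 0) = 1)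
  obtain ⟨s, hs⟩ := exists_shuffleScheme (E := E) (A := A) (T := T) (I := I) enc
    (by
      intro l v v' h
      funext i
      have : ∀ k ∈ i.1.1.erase l, g i.1.1 k v = g i.1.1 k v' := by
        intro k hk
        refine hg _ _ _ _ fun z => h _ ?_
        have hz := (Finset.mem_filter.1 z.2).2.2
        rw [← mem_mappers, hz, Finset.mem_erase]
        exact ⟨(Finset.ne_of_mem_erase hk).symm, i.1.2.2⟩
      simp only [enc]
      rw [Finset.sum_congr rfl fun k hk => by rw [this k hk]])
    (by
      intro k v v' hloc hm e he1 he2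
      set U := insert k (mappers A e.1.2) with hU
      have hk : k ∉ mappers A e.1.2 := fun h => he2 (mem_mappers.1 h)
      have hUk : U.erase k = mappers A e.1.2 := Finset.erase_insert hk
      have hkU : k ∈ U := Finset.mem_insert_self _ _
      have hUc : U.card = r + 1 := by rw [hU, Finset.card_insert_of_notMem hk, hA]
      have hez : e.1 ∈ groupPairs A U k :=
        Finset.mem_filter.2 ⟨Finset.mem_univ _, he1, hUk.symm⟩
      obtain ⟨hinj, hran⟩ := hφ U k hUc hkU
      funext t
      set z : Z U k × Fin T := (⟨e, hez⟩, t) with hz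
      obtain ⟨hl, ht⟩ := hran z
      have hlk := Finset.ne_of_mem_erase hl
      have hlU := Finset.mem_of_mem_erase hl
      have hmsg := congrFun (hm _ hlk)
        ⟨⟨U, Finset.mem_powersetCard.2 ⟨Finset.subset_univ _, hUc⟩, hlU⟩, ⟨_, ht⟩⟩
      have hsum := zmod_two_ext hmsg
      have hkmem : k ∈ U.erase (φ U k z).1 := Finset.mem_erase.2 ⟨hlk.symm, hkU⟩
      simp only at hsum
      rw [← Finset.add_sum_erase _ _ hkmem, ← Finset.add_sum_erase _ _ hkmem] at hsum
      -- A value intended for `k' ≠ k` is Mapped by all of `U.erase k'`, which contains `k`, so its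
      -- term cancels.
      have hoth : ∀ k' ∈ (U.erase (φ U k z).1).erase k, g U k' v = g U k' v' := by
        intro k' hk'
        refine hg _ _ _ _ fun z' => hloc _ ?_
        have hz' := (Finset.mem_filter.1 z'.2).2.2
        rw [← mem_mappers, hz', Finset.mem_erase]
        exact ⟨(Finset.ne_of_mem_erase hk').symm, hkU⟩
      rw [Finset.sum_congr rfl fun k' hk' => by rw [hoth k' hk']] at hsum
      have hterm := add_right_cancel hsum
      have hgz : ∀ v, g U k v ((φ U k z).1, (φ U k z).2) = v e t := fun v =>
        hinj.extend_apply _ _ z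
      rw [hgz, hgz] at hterm
      revert hterm
      cases v e t <;> cases v' e t <;> simp)
  refine (minBits_le s).trans (le_of_eq ?_)
  have hcard : ∀ l, s.len l = ∑ U ∈ Finset.univ.powersetCard (r + 1),
      if l ∈ U then c U else 0 := by
    intro l
    rw [hs, Fintype.card_sigma, ← Finset.sum_filter]
    simp only [Fintype.card_fin]
    rw [Finset.sum_subtype ((Finset.univ.powersetCard (r + 1)).filter fun U => l ∈ U)
      (p := fun U => U ∈ Finset.univ.powersetCard (r + 1) ∧ l ∈ U) (by simp)]
  simp_rw [hcard]
  rw [Finset.sum_comm]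
  refine Finset.sum_congr rfl fun U hU => ?_
  rw [Finset.sum_ite_mem, Finset.univ_inter, Finset.sum_const, (Finset.mem_powersetCard.1 hU).2,
    smul_eq_mul]

lemma mean_minBits_le {w : Sym2 V → ℝ} (h0 : ∀ e, 0 ≤ w e) (h1 : ∀ e, w e ≤ 1)
    {A : Allocation V K} {r : ℕ} (hr : 1 ≤ r) (T : ℕ) (hA : ∀ j, (mappers A j).card = r)
    {m : ℝ} (hm : 0 < m)
    (hmean : ∀ U k, ∑ x ∈ groupPairs A U k, w s(x.1, x.2) ≤ m) :
    ∑ E, graphProb w E * (minBits E A T : ℝ)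
      ≤ (K.choose (r + 1) : ℝ) * ((r + 1) * ((m + (r + 1) * (2 * √m)) * T / r + 1)) := by
  have hr0 : (0 : ℝ) < r := by exact_mod_cast hr
  let dev : Finset (Fin K) → Fin K → Finset (Sym2 V) → ℝ := fun U k E =>
    |(edgeCount (groupPairs A U k) E : ℝ) - ∑ x ∈ groupPairs A U k, w s(x.1, x.2)|
  have hpt : ∀ E, (minBits E A T : ℝ) ≤ ∑ U ∈ Finset.univ.powersetCard (r + 1),
      ((r : ℝ) + 1) * ((m + ∑ k ∈ U, dev U k E) * T / r + 1) := by
    intro E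
    have hnn : ∀ U, 0 ≤ (m + ∑ k ∈ U, dev U k E) * T / r := fun U => by
      have : 0 ≤ ∑ k ∈ U, dev U k E := Finset.sum_nonneg fun k _ => abs_nonneg _
      positivity
    -- The sum of all deviations in the group dominates every member's deviation and is linear under
    -- the mean, unlike the maximum.
    have h := minBits_le_coded E A T r hA (fun U => ⌈(m + ∑ k ∈ U, dev U k E) * T / r⌉₊) (by
      intro U k _ hk
      have h1 : (edgeCount (groupPairs A U k) E : ℝ) ≤ m + ∑ k ∈ U, dev U k E := by
        have h2 : dev U k E ≤ ∑ k ∈ U, dev U k E :=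
          Finset.single_le_sum (f := fun k => dev U k E) (fun k _ => abs_nonneg _) hk
        have h3 := le_abs_self ((edgeCount (groupPairs A U k) E : ℝ)
          - ∑ x ∈ groupPairs A U k, w s(x.1, x.2))
        have h4 := hmean U k
        simp only [dev] at h2 ⊢
        linarith
      have h2 := Nat.le_ceil ((m + ∑ k ∈ U, dev U k E) * T / r)
      rw [div_le_iff₀ hr0] at h2
      have h3 : (edgeCount (groupPairs A U k) E : ℝ) * T ≤ (m + ∑ k ∈ U, dev U k E) * T := by
        gcongr
      have h4 := h3.trans h2
      rw [mul_comm (_ : ℝ) (r : ℝ)] at h4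
      exact_mod_cast h4)
    refine (Nat.cast_le (α := ℝ).2 h).trans ?_
    push_cast
    refine Finset.sum_le_sum fun U _ => ?_
    gcongr
    exact (Nat.ceil_lt_add_one (hnn U)).le
  have hdev : ∀ U k, ∑ E, graphProb w E * dev U k E ≤ 2 * √m := fun U k =>
    mean_abs_edgeCount_le h0 h1 _ hm (hmean U k)
  have hU : ∀ U ∈ (Finset.univ : Finset (Fin K)).powersetCard (r + 1),
      ∑ E, graphProb w E * (((r : ℝ) + 1) * ((m + ∑ k ∈ U, dev U k E) * T / r + 1))
      ≤ (r + 1) * ((m + (r + 1) * (2 * √m)) * T / r + 1) := by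
    intro U hU
    have hexp : ∑ E, graphProb w E * (((r : ℝ) + 1) * ((m + ∑ k ∈ U, dev U k E) * T / r + 1))
        = (r + 1) * ((m * (∑ E, graphProb w E) + ∑ k ∈ U, ∑ E, graphProb w E * dev U k E) * T / r
          + ∑ E, graphProb w E) := by
      rw [Finset.sum_comm (s := U)]
      simp_rw [← Finset.mul_sum]
      rw [Finset.mul_sum, ← Finset.sum_add_distrib, Finset.sum_mul, Finset.sum_div,
        ← Finset.sum_add_distrib, Finset.mul_sum]
      exact Finset.sum_congr rfl fun E _ => by ring
    rw [hexp, sum_graphProb]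
    have hs := Finset.sum_le_sum fun k (_ : k ∈ U) => hdev U k
    rw [Finset.sum_const, (Finset.mem_powersetCard.1 hU).2, nsmul_eq_mul] at hs
    push_cast at hs
    rw [mul_one]
    gcongr
  calc _ ≤ ∑ E, graphProb w E * ∑ U ∈ Finset.univ.powersetCard (r + 1),
        ((r : ℝ) + 1) * ((m + ∑ k ∈ U, dev U k E) * T / r + 1) :=
        Finset.sum_le_sum fun E _ =>
          mul_le_mul_of_nonneg_left (hpt E) (graphProb_nonneg h0 h1 E)
    _ = ∑ U ∈ Finset.univ.powersetCard (r + 1), ∑ E, graphProb w E *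
          (((r : ℝ) + 1) * ((m + ∑ k ∈ U, dev U k E) * T / r + 1)) := by
        simp_rw [Finset.mul_sum (Finset.univ.powersetCard (r + 1))]
        rw [Finset.sum_comm]
    _ ≤ ∑ U ∈ (Finset.univ : Finset (Fin K)).powersetCard (r + 1),
          ((r : ℝ) + 1) * ((m + (r + 1) * (2 * √m)) * T / r + 1) := Finset.sum_le_sum hU
    _ = _ := by
        rw [Finset.sum_const, Finset.card_powersetCard, Finset.card_univ, Fintype.card_fin,
          nsmul_eq_mul]

end Coding

/-! ### Sums of periodic functions over intervals -/

section Counting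

lemma sum_range_mul_eq (f : ℕ → ℕ) (L t : ℕ) :
    ∑ x ∈ Finset.range (L * t), f x
      = ∑ b ∈ Finset.range t, ∑ y ∈ Finset.range L, f (L * b + y) := by
  induction t with
  | zero => simp
  | succ t ih => rw [Nat.mul_succ, Finset.sum_range_add, ih, Finset.sum_range_succ]

lemma sum_range_shift_eq {f : ℕ → ℕ} {L : ℕ} (hf : Function.Periodic f L) (a : ℕ) :
    ∑ x ∈ Finset.range L, f (a + x) = ∑ x ∈ Finset.range L, f x := by
  induction a with
  | zero => simp
  | succ a ih =>
    have h := Finset.sum_range_succ (fun x => f (a + x)) L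
    rw [Finset.sum_range_succ', hf a, ih, add_zero] at h
    rw [← add_right_cancel h]
    exact Finset.sum_congr rfl fun x _ => by congr 1; ring

/-- The interval is covered by `m / L + 1` whole periods, whatever its starting point. -/
lemma sum_range_periodic_le {f : ℕ → ℕ} {L c : ℕ} (hL : 0 < L) (hf : Function.Periodic f L)
    (hc : ∑ x ∈ Finset.range L, f x ≤ c) (a m : ℕ) :
    ((∑ x ∈ Finset.range m, f (a + x) : ℕ) : ℝ) ≤ (m : ℝ) / L * c + c := by
  have h1 : ∑ x ∈ Finset.range m, f (a + x) ≤ (m / L + 1) * c := by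
    calc _ ≤ ∑ x ∈ Finset.range (L * (m / L + 1)), f (a + x) :=
          Finset.sum_le_sum_of_subset (Finset.range_subset_range.2
            (by have := Nat.lt_mul_div_succ m hL; exact this.le))
      _ = ∑ b ∈ Finset.range (m / L + 1), ∑ y ∈ Finset.range L, f (a + L * b + y) := by
          rw [sum_range_mul_eq (fun x => f (a + x))]
          simp only [add_assoc]
      _ ≤ ∑ b ∈ Finset.range (m / L + 1), c :=
          Finset.sum_le_sum fun b _ => (sum_range_shift_eq hf _).le.trans hc
      _ = _ := by simp
  calc ((∑ x ∈ Finset.range m, f (a + x) : ℕ) : ℝ) ≤ (((m / L + 1) * c : ℕ) : ℝ) := by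
        exact_mod_cast h1
    _ = ((m / L : ℕ) : ℝ) * c + c := by push_cast; ring
    _ ≤ (m : ℝ) / L * c + c := by gcongr; exact Nat.cast_div_le

end Counting

/-! ### An allocation spread evenly over both clusters -/

section CyclicAllocation

variable (K r : ℕ) [NeZero K] [NeZero (K.choose r)]

/-- An enumeration of the `r`-subsets of the machines, repeated periodically. -/
def subsetSeq (b : ℕ) : Finset (Fin K) :=
  ((Finset.univ.powersetCard r : Finset (Finset (Fin K))).equivFinOfCardEq
    (by simp : _ = K.choose r)).symm (Fin.ofNat (K.choose r) b)

omit [NeZero K] in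
lemma card_subsetSeq (b : ℕ) : (subsetSeq K r b).card = r :=
  (Finset.mem_powersetCard.1 (Subtype.prop _)).2

omit [NeZero K] in
lemma subsetSeq_periodic : Function.Periodic (subsetSeq K r) (K.choose r) := by
  intro b
  have h : Fin.ofNat (K.choose r) (b + K.choose r) = Fin.ofNat (K.choose r) b := by
    ext
    simp
  rw [subsetSeq, h, subsetSeq]

omit [NeZero K] in
lemma subsetSeq_inj {b b' : ℕ} (hb : b < K.choose r) (hb' : b' < K.choose r)
    (h : subsetSeq K r b = subsetSeq K r b') : b = b' := by
  have := congrArg Fin.val (Equiv.injective _ (Subtype.ext h))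
  simpa [Nat.mod_eq_of_lt, hb, hb'] using this

/-- The machines that Map the `x`-th vertex: every block of `K` vertices runs through the cyclic
shifts of one `r`-subset. -/
def cyclicMappers (x : ℕ) : Finset (Fin K) :=
  (subsetSeq K r (x / K)).map (Equiv.addRight (Fin.ofNat K x)).toEmbedding

lemma card_cyclicMappers (x : ℕ) : (cyclicMappers K r x).card = r := by
  rw [cyclicMappers, Finset.card_map, card_subsetSeq]

lemma cyclicMappers_block (b : ℕ) (s : Fin K) :
    cyclicMappers K r (K * b + s) = (subsetSeq K r b).map (Equiv.addRight s).toEmbedding := by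
  have h1 : (K * b + s) / K = b := by
    rw [Nat.mul_add_div (NeZero.pos K), Nat.div_eq_of_lt s.2, add_zero]
  have h2 : Fin.ofNat K (K * b + s) = s := by
    ext
    simp [Nat.mod_eq_of_lt s.2]
  rw [cyclicMappers, h1, h2]

lemma cyclicMappers_periodic : Function.Periodic (cyclicMappers K r) (K * K.choose r) := by
  intro x
  have h1 : (x + K * K.choose r) / K = x / K + K.choose r :=
    Nat.add_mul_div_left _ _ (NeZero.pos K)
  have h2 : Fin.ofNat K (x + K * K.choose r) = Fin.ofNat K x := by
    ext
    simp
  rw [cyclicMappers, h1, h2, subsetSeq_periodic, cyclicMappers]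

/-- Among the `K` cyclic shifts of an `r`-subset exactly `r` contain `k`. Loads are thus balanced in
every block, so they are exact for all multiples of `K`, not only for multiples of the full period.
-/
lemma sum_mem_cyclicMappers (k : Fin K) (t : ℕ) :
    ∑ x ∈ Finset.range (K * t), (if k ∈ cyclicMappers K r x then 1 else 0) = r * t := by
  rw [sum_range_mul_eq]
  have : ∀ b, ∑ y ∈ Finset.range K, (if k ∈ cyclicMappers K r (K * b + y) then 1 else 0) = r := by
    intro b
    rw [Finset.sum_range (fun y => if k ∈ cyclicMappers K r (K * b + y) then 1 else 0)]
    simp_rw [cyclicMappers_block, Finset.mem_map_equiv]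
    rw [← Equiv.sum_comp (Equiv.subLeft k)]
    have hs : ∀ y : Fin K, (Equiv.addRight (Equiv.subLeft k y)).symm k = y := fun y => by
      rw [Equiv.symm_apply_eq]
      simp
    simp_rw [hs]
    simp [card_subsetSeq]
  simp [this, mul_comm]

/-- For a fixed offset in the block, the shift is injective and the subsets within a period are
distinct, so `B` occurs at most once per offset. -/
lemma sum_cyclicMappers_eq_le (B : Finset (Fin K)) :
    ∑ x ∈ Finset.range (K * K.choose r), (if cyclicMappers K r x = B then 1 else 0) ≤ K := by
  rw [sum_range_mul_eq, Finset.sum_comm]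
  calc _ ≤ ∑ y ∈ Finset.range K, 1 := by
        refine Finset.sum_le_sum fun y hy => ?_
        rw [← Finset.card_filter, Finset.card_le_one]
        intro b hb b' hb'
        rw [Finset.mem_filter, Finset.mem_range] at hb hb'
        have hbb := hb.2.trans hb'.2.symm
        have hs := cyclicMappers_block K r b ⟨y, Finset.mem_range.1 hy⟩
        have hs' := cyclicMappers_block K r b' ⟨y, Finset.mem_range.1 hy⟩
        simp only at hs hs'
        rw [hs, hs', Finset.map_inj] at hbb
        exact subsetSeq_inj K r hb.1 hb'.1 hbb
    _ = K := by simp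

omit [NeZero K] [NeZero (K.choose r)] in
lemma sum_mod_eq (k : Fin K) (t : ℕ) :
    ∑ x ∈ Finset.range (K * t), (if x % K = k then 1 else 0) = t := by
  rw [sum_range_mul_eq]
  have : ∀ b, ∑ y ∈ Finset.range K, (if (K * b + y) % K = k then 1 else 0) = 1 := by
    intro b
    rw [Finset.sum_range (fun y => if (K * b + y) % K = k then 1 else 0)]
    have : ∀ y : Fin K, ((K * b + y) % K = k) ↔ y = k := fun y => by
      rw [Nat.mul_add_mod, Nat.mod_eq_of_lt y.2, Fin.val_inj]
    simp only [this, Finset.sum_ite_eq', Finset.mem_univ, if_true]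
  simp only [this, Finset.sum_const, Finset.card_range, smul_eq_mul, mul_one]

variable (n₁ n₂ : ℕ)

/-- The position of a vertex when the first cluster is listed before the second one. -/
def position : Fin n₁ ⊕ Fin n₂ → ℕ := Sum.elim (fun a => a) (fun a => n₁ + a)

/-- The allocation that spreads both Mappers and Reducers evenly over the two clusters. -/
def cyclicAllocation : Allocation (Fin n₁ ⊕ Fin n₂) K where
  M k := Finset.univ.filter fun v => k ∈ cyclicMappers K r (position n₁ n₂ v)
  R k := Finset.univ.filter fun v => position n₁ n₂ v % K = k

lemma mappers_cyclicAllocation (v : Fin n₁ ⊕ Fin n₂) :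
    mappers (cyclicAllocation K r n₁ n₂) v = cyclicMappers K r (position n₁ n₂ v) := by
  ext k
  simp [mappers, cyclicAllocation]

lemma card_filter_position (P : ℕ → Prop) [DecidablePred P] :
    (Finset.univ.filter fun v => P (position n₁ n₂ v)).card
      = ∑ x ∈ Finset.range (n₁ + n₂), if P x then 1 else 0 := by
  rw [Finset.card_filter, Fintype.sum_sum_type, Finset.sum_range_add,
    Finset.sum_range, Finset.sum_range (n := n₂)]
  rfl

lemma cyclicAllocation_mem (hr : 1 ≤ r) (hn : K ∣ n₁ + n₂) (equal : Prop) :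
    cyclicAllocation K r n₁ n₂ ∈ allocations (Fin n₁ ⊕ Fin n₂) K r equal := by
  obtain ⟨t, ht⟩ := hn
  have hcard : Fintype.card (Fin n₁ ⊕ Fin n₂) = K * t := by simp [ht]
  have hM : ∀ k, ((cyclicAllocation K r n₁ n₂).M k).card = r * t := fun k => by
    rw [← sum_mem_cyclicMappers K r k t, ← ht]
    exact card_filter_position n₁ n₂ fun x => k ∈ cyclicMappers K r x
  have hR : ∀ k, ((cyclicAllocation K r n₁ n₂).R k).card = t := fun k => by
    refine Eq.trans ?_ (sum_mod_eq K k t)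
    rw [← ht]
    exact card_filter_position n₁ n₂ fun x => x % K = k
  refine ⟨fun v => ?_, ?_, fun k l hkl => ?_, fun v => ?_, fun k => ?_, fun _ k => ?_⟩
  · have : (mappers (cyclicAllocation K r n₁ n₂) v).Nonempty := by
      rw [← Finset.card_pos, mappers_cyclicAllocation, card_cyclicMappers]
      exact hr
    obtain ⟨k, hk⟩ := this
    exact ⟨k, mem_mappers.1 hk⟩
  · simp only [hM, hcard, Finset.sum_const, Finset.card_univ, Fintype.card_fin, smul_eq_mul]
    ring
  · rw [Finset.disjoint_left]
    intro v hv hv'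
    exact hkl (Fin.ext ((Finset.mem_filter.1 hv).2.symm.trans (Finset.mem_filter.1 hv').2))
  · exact ⟨⟨position n₁ n₂ v % K, Nat.mod_lt _ (NeZero.pos K)⟩,
      Finset.mem_filter.2 ⟨Finset.mem_univ _, rfl⟩⟩
  · rw [hR, hcard]
  · rw [hM, hcard]
    ring

lemma sum_sbmProb_product (p q : ℝ) (P Q : ℕ → Prop) [DecidablePred P] [DecidablePred Q] :
    (∑ x : (Fin n₁ ⊕ Fin n₂) × (Fin n₁ ⊕ Fin n₂),
      if P (position n₁ n₂ x.1) ∧ Q (position n₁ n₂ x.2)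
        then sbmProb n₁ n₂ p q s(x.1, x.2) else 0)
    = p * (((∑ a ∈ Finset.range n₁, if P (0 + a) then 1 else 0 : ℕ) : ℝ)
          * (∑ a ∈ Finset.range n₁, if Q (0 + a) then 1 else 0 : ℕ)
        + ((∑ a ∈ Finset.range n₂, if P (n₁ + a) then 1 else 0 : ℕ) : ℝ)
          * (∑ a ∈ Finset.range n₂, if Q (n₁ + a) then 1 else 0 : ℕ))
      + q * (((∑ a ∈ Finset.range n₁, if P (0 + a) then 1 else 0 : ℕ) : ℝ)
          * (∑ a ∈ Finset.range n₂, if Q (n₁ + a) then 1 else 0 : ℕ)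
        + ((∑ a ∈ Finset.range n₂, if P (n₁ + a) then 1 else 0 : ℕ) : ℝ)
          * (∑ a ∈ Finset.range n₁, if Q (0 + a) then 1 else 0 : ℕ)) := by
  have key : ∀ {m m' : ℕ} (u : ℝ) (f : Fin m → Prop) (g : Fin m' → Prop)
      [DecidablePred f] [DecidablePred g],
      ∑ i, ∑ j, (if f i ∧ g j then u else 0)
        = u * ((∑ i, if f i then (1 : ℝ) else 0) * ∑ j, if g j then (1 : ℝ) else 0) := by
    intro m m' u f g _ _
    rw [Finset.sum_mul_sum, Finset.mul_sum]
    refine Finset.sum_congr rfl fun i _ => ?_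
    rw [Finset.mul_sum]
    refine Finset.sum_congr rfl fun j _ => ?_
    by_cases h1 : f i <;> by_cases h2 : g j <;> simp [h1, h2]
  simp only [Fintype.sum_prod_type, Fintype.sum_sum_type, Finset.sum_add_distrib, position,
    Sum.elim_inl, Sum.elim_inr, sbmProb, Sym2.lift_mk, Sum.isLeft_inl, Sum.isLeft_inr, if_true,
    reduceCtorEq, if_false, key, Finset.sum_range, zero_add, Nat.cast_sum, Nat.cast_ite,
    Nat.cast_one, Nat.cast_zero]
  ring

/-- Within a cluster of size `m`, a residue class has at most `m / K + 1` members and a Mapper set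
occurs at most `m / K.choose r + K` times. Each of the four cluster pairs then has error at most `(K
+ 2) n`, weighted by `p` or by `q ≤ p`. -/
lemma mean_groupPairs_le {p q : ℝ} (hq : 0 ≤ q) (hqp : q ≤ p) (hn : 1 ≤ n₁ + n₂)
    (U : Finset (Fin K)) (k : Fin K) :
    ∑ x ∈ groupPairs (cyclicAllocation K r n₁ n₂) U k, sbmProb n₁ n₂ p q s(x.1, x.2)
      ≤ (p * (n₁ : ℝ) ^ 2 + p * (n₂ : ℝ) ^ 2 + 2 * q * (n₁ : ℝ) * (n₂ : ℝ))
          / (K * K.choose r) + 4 * (K + 2) * (p * ((n₁ : ℝ) + n₂)) := by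
  have hp : 0 ≤ p := hq.trans hqp
  have hK1 : (1 : ℝ) ≤ K := by exact_mod_cast NeZero.one_le
  have hN1 : (1 : ℝ) ≤ K.choose r := by exact_mod_cast NeZero.one_le (n := K.choose r)
  have hsum : ∑ x ∈ groupPairs (cyclicAllocation K r n₁ n₂) U k, sbmProb n₁ n₂ p q s(x.1, x.2)
      = ∑ x : (Fin n₁ ⊕ Fin n₂) × (Fin n₁ ⊕ Fin n₂),
        if position n₁ n₂ x.1 % K = k ∧ cyclicMappers K r (position n₁ n₂ x.2) = U.erase k
          then sbmProb n₁ n₂ p q s(x.1, x.2) else 0 := by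
    rw [groupPairs, Finset.sum_filter]
    refine Finset.sum_congr rfl fun x _ => ?_
    rw [mappers_cyclicAllocation]
    simp only [cyclicAllocation, Finset.mem_filter, Finset.mem_univ, true_and]
  have hsum2 := sum_sbmProb_product n₁ n₂ p q (fun x => x % K = k)
    (fun x => cyclicMappers K r x = U.erase k)
  have hρ : ∀ a m : ℕ, ((∑ x ∈ Finset.range m, if (a + x) % K = k then 1 else 0 : ℕ) : ℝ)
      ≤ m / K + 1 := by
    intro a m
    have h := sum_range_periodic_le (f := fun x => if x % K = k then 1 else 0) (c := 1)
      (NeZero.pos K) (fun x => by simp)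
      (by simpa using (sum_mod_eq K k 1).le) a m
    simpa using h
  have hφ : ∀ a m : ℕ,
      ((∑ x ∈ Finset.range m, if cyclicMappers K r (a + x) = U.erase k then 1 else 0 : ℕ) : ℝ)
      ≤ m / K.choose r + K := by
    intro a m
    have h := sum_range_periodic_le (L := K * K.choose r)
      (f := fun x => if cyclicMappers K r x = U.erase k then 1 else 0) (c := K)
      (Nat.mul_pos (NeZero.pos K) (NeZero.pos _))
      (fun x => by simp only [cyclicMappers_periodic K r x])
      (sum_cyclicMappers_eq_le K r _) a m
    refine h.trans (le_of_eq ?_)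
    push_cast
    field_simp
  have hprod : ∀ {m m' : ℕ} {ρ φ : ℝ}, m ≤ n₁ + n₂ → m' ≤ n₁ + n₂ → 0 ≤ φ →
      ρ ≤ m / K + 1 → φ ≤ m' / K.choose r + K →
      ρ * φ ≤ m * m' / (K * K.choose r) + (K + 2) * ((n₁ : ℝ) + n₂) := by
    intro m m' ρ φ hm hm' hφ0 h1 h2
    have hm : (m : ℝ) ≤ (n₁ : ℝ) + n₂ := by exact_mod_cast hm
    have hm' : (m' : ℝ) ≤ (n₁ : ℝ) + n₂ := by exact_mod_cast hm'
    have hn : (1 : ℝ) ≤ (n₁ : ℝ) + n₂ := by exact_mod_cast hn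
    have hdiv : (m' : ℝ) / K.choose r ≤ m' := div_le_self (by positivity) hN1
    calc ρ * φ ≤ (m / K + 1) * (m' / K.choose r + K) := by gcongr
      _ = m * m' / (K * K.choose r) + (m + m' / K.choose r + K * 1) := by
          field_simp
          ring
      _ ≤ m * m' / (K * K.choose r)
          + (((n₁ : ℝ) + n₂) + ((n₁ : ℝ) + n₂) + K * ((n₁ : ℝ) + n₂)) := by
          gcongr
          exact hdiv.trans hm'
      _ = _ := by ring
  rw [hsum, hsum2]
  have h11 := hprod (Nat.le_add_right n₁ n₂) (Nat.le_add_right n₁ n₂) (Nat.cast_nonneg _)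
    (hρ 0 n₁) (hφ 0 n₁)
  have h22 := hprod (Nat.le_add_left n₂ n₁) (Nat.le_add_left n₂ n₁) (Nat.cast_nonneg _)
    (hρ n₁ n₂) (hφ n₁ n₂)
  have h12 := hprod (Nat.le_add_right n₁ n₂) (Nat.le_add_left n₂ n₁) (Nat.cast_nonneg _)
    (hρ 0 n₁) (hφ n₁ n₂)
  have h21 := hprod (Nat.le_add_left n₂ n₁) (Nat.le_add_right n₁ n₂) (Nat.cast_nonneg _)
    (hρ n₁ n₂) (hφ 0 n₁)
  set e : ℝ := (K + 2) * ((n₁ : ℝ) + n₂) with he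
  have he0 : 0 ≤ e := by positivity
  have hqe : q * e ≤ p * e := by gcongr
  refine (add_le_add (mul_le_mul_of_nonneg_left (add_le_add h11 h22) hp)
    (mul_le_mul_of_nonneg_left (add_le_add h12 h21) hq)).trans ?_
  have e1 : (p * (n₁ : ℝ) ^ 2 + p * (n₂ : ℝ) ^ 2 + 2 * q * (n₁ : ℝ) * (n₂ : ℝ))
          / (K * K.choose r) + 4 * (K + 2) * (p * ((n₁ : ℝ) + n₂))
      = p * ((n₁ : ℝ) * n₁ / (K * K.choose r) + (n₂ : ℝ) * n₂ / (K * K.choose r))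
        + q * ((n₁ : ℝ) * n₂ / (K * K.choose r) + (n₂ : ℝ) * n₁ / (K * K.choose r))
        + 4 * (p * e) := by
    rw [he]
    ring
  rw [e1]
  nlinarith

end CyclicAllocation

/-! ### Explicit bounds for the block model -/

section Asymptotics

lemma sbmProb_mem {n₁ n₂ : ℕ} {p q : ℝ} (hqp : q ≤ p) (e : Sym2 (Fin n₁ ⊕ Fin n₂)) :
    q ≤ sbmProb n₁ n₂ p q e ∧ sbmProb n₁ n₂ p q e ≤ p := by
  induction e with
  | _ a b =>
    simp only [sbmProb, Sym2.lift_mk]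
    split_ifs <;> simp [hqp]

lemma avgLoad_nonneg {V : Type*} [Fintype V] [DecidableEq V] {K : ℕ} {w : Sym2 V → ℝ}
    (h0 : ∀ e, 0 ≤ w e) (h1 : ∀ e, w e ≤ 1) (A : Allocation V K) (T : ℕ) :
    0 ≤ avgLoad w A T :=
  Finset.sum_nonneg fun E _ => mul_nonneg (graphProb_nonneg h0 h1 E)
    (by unfold load; positivity)

lemma sbmOptLoad_le {K r T n₁ n₂ : ℕ} {p q : ℝ} (hr : 1 ≤ r) (hrK : r ≤ K) (hT : 1 ≤ T)
    (hq : 0 ≤ q) (hqp : q ≤ p) (hp0 : 0 < p) (hp : p ≤ 1) (hn : 1 ≤ n₁ + n₂)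
    (hK : K ∣ n₁ + n₂) (equal : Prop) {m : ℝ}
    (hm : m = (p * (n₁ : ℝ) ^ 2 + p * (n₂ : ℝ) ^ 2 + 2 * q * (n₁ : ℝ) * (n₂ : ℝ))
          / (K * K.choose r) + 4 * (K + 2) * (p * ((n₁ : ℝ) + n₂))) :
    sbmOptLoad n₁ n₂ p q K r T equal
      ≤ (K.choose (r + 1) : ℝ) * ((r + 1) * ((m + (r + 1) * (2 * √m)) / r + 1))
        / ((n₁ : ℝ) + n₂) ^ 2 := by
  have : NeZero K := ⟨by omega⟩
  have : NeZero (K.choose r) := ⟨(Nat.choose_pos hrK).ne'⟩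
  have hn0 : (0 : ℝ) < (n₁ : ℝ) + n₂ := by exact_mod_cast hn
  have hT1 : (1 : ℝ) ≤ T := by exact_mod_cast hT
  have hT0 : (0 : ℝ) < T := by linarith
  have hm0 : 0 < m := by
    rw [hm]
    positivity
  have h0 : ∀ e, 0 ≤ sbmProb n₁ n₂ p q e := fun e => hq.trans (sbmProb_mem hqp e).1
  have h1 : ∀ e, sbmProb n₁ n₂ p q e ≤ 1 := fun e => (sbmProb_mem hqp e).2.trans hp
  have hle : sbmOptLoad n₁ n₂ p q K r T equal
      ≤ avgLoad (sbmProb n₁ n₂ p q) (cyclicAllocation K r n₁ n₂) T := by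
    refine csInf_le ⟨0, ?_⟩ (Set.mem_image_of_mem _ (cyclicAllocation_mem K r n₁ n₂ hr hK equal))
    rintro _ ⟨A, -, rfl⟩
    exact avgLoad_nonneg h0 h1 A T
  have hmean := mean_minBits_le h0 h1 (A := cyclicAllocation K r n₁ n₂) hr T
    (fun j => by rw [mappers_cyclicAllocation, card_cyclicMappers]) hm0
    (fun U k => hm ▸ mean_groupPairs_le K r n₁ n₂ hq hqp hn U k)
  refine hle.trans ?_
  have havg : avgLoad (sbmProb n₁ n₂ p q) (cyclicAllocation K r n₁ n₂) T
      = (∑ E, graphProb (sbmProb n₁ n₂ p q) E * (minBits E (cyclicAllocation K r n₁ n₂) T : ℝ))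
        / (((n₁ : ℝ) + n₂) ^ 2 * T) := by
    rw [Finset.sum_div]
    refine Finset.sum_congr rfl fun E _ => ?_
    rw [load, Fintype.card_sum, Fintype.card_fin, Fintype.card_fin]
    push_cast
    ring
  rw [havg, div_le_div_iff₀ (by positivity) (by positivity)]
  -- The rounding term 1 is at most `T`, so the bound becomes independent of `T` after
  -- normalization.
  have hstep : (K.choose (r + 1) : ℝ) * ((r + 1) * ((m + (r + 1) * (2 * √m)) * T / r + 1))
      ≤ (K.choose (r + 1) : ℝ) * ((r + 1) * ((m + (r + 1) * (2 * √m)) / r + 1)) * T := by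
    have : (K.choose (r + 1) : ℝ) * ((r + 1) * ((m + (r + 1) * (2 * √m)) / r + 1)) * T
        = (K.choose (r + 1) : ℝ) * ((r + 1) * ((m + (r + 1) * (2 * √m)) * T / r + T)) := by ring
    rw [this]
    gcongr
  calc _ ≤ (K.choose (r + 1) : ℝ) * ((r + 1) * ((m + (r + 1) * (2 * √m)) / r + 1)) * T
        * ((n₁ : ℝ) + n₂) ^ 2 := by gcongr; exact hmean.trans hstep
    _ = _ := by ring

lemma choose_identity {K r : ℕ} (hr : 1 ≤ r) (hrK : r ≤ K) :
    (K.choose (r + 1) : ℝ) * ((r + 1) * (1 / (K * K.choose r) / r))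
      = 1 / (r : ℝ) * (1 - (r : ℝ) / (K : ℝ)) := by
  have h := Nat.choose_succ_right_eq K r
  have h' : (K.choose (r + 1) : ℝ) * (r + 1) = K.choose r * (K - r) := by
    rw [← Nat.cast_sub hrK]
    exact_mod_cast h
  have hr0 : (r : ℝ) ≠ 0 := by positivity
  have hK0 : (K : ℝ) ≠ 0 := by
    have : 0 < K := by omega
    positivity
  have hN0 : (K.choose r : ℝ) ≠ 0 := by exact_mod_cast (Nat.choose_pos hrK).ne'
  rw [← mul_assoc, h']
  field_simp

lemma atTopDvd_neBot {K : ℕ} (hK : 0 < K) : (atTopDvd K).NeBot := by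
  rw [atTopDvd, ← frequently_mem_iff_neBot, frequently_atTop]
  exact fun a => ⟨K * a, Nat.le_mul_of_pos_left a hK, K.dvd_mul_right a⟩

end Asymptotics

end GraphMapReduce

end

/-! ### The theorem -/

theorem theorem3 (K r : ℕ) (hr : 1 ≤ r) (hrK : r ≤ K) (equal : Prop)
    (n₁ n₂ T : ℕ → ℕ) (p q : ℕ → ℝ)
    (hn : ∀ n, n₁ n + n₂ n = n)
    (hT : ∀ n, 1 ≤ T n)
    (hq : ∀ n, 0 < q n) (hqp : ∀ n, q n < p n) (hp : ∀ n, p n ≤ 1)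
    (hn₁ : (fun n => (n₁ n : ℝ)) =Θ[GraphMapReduce.atTopDvd K] (fun n => (n : ℝ)))
    (hn₂ : (fun n => (n₂ n : ℝ)) =Θ[GraphMapReduce.atTopDvd K] (fun n => (n : ℝ)))
    (hpω : (fun n : ℕ => 1 / (n : ℝ) ^ 2) =o[GraphMapReduce.atTopDvd K] p)
    (hqω : (fun n : ℕ => 1 / (n : ℝ) ^ 2) =o[GraphMapReduce.atTopDvd K] q) :
    limsup (fun n : ℕ =>
        ((GraphMapReduce.sbmOptLoad (n₁ n) (n₂ n) (p n) (q n) K r (T n) equal /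
          ((p n * (n₁ n : ℝ) ^ 2 + p n * (n₂ n : ℝ) ^ 2 + 2 * q n * (n₁ n : ℝ) * (n₂ n : ℝ)) /
            ((n₁ n : ℝ) + (n₂ n : ℝ)) ^ 2) : ℝ) : EReal))
        (GraphMapReduce.atTopDvd K)
      ≤ ((1 / (r : ℝ) * (1 - (r : ℝ) / (K : ℝ)) : ℝ) : EReal) ∧
    ∀ n, 0 < n → K ∣ n →
      GraphMapReduce.sbmOptLoad (n₁ n) (n₂ n) (p n) (q n) K r (T n) equal / q n
        ≥ 1 / (r : ℝ) * (1 - (r : ℝ) / (K : ℝ)) := by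
  have hK0 : 0 < K := by omega
  have hp0 : ∀ n, 0 < p n := fun n => (hq n).trans (hqp n)
  refine ⟨?_, fun n hn0 hKn => ?_⟩
  · have := GraphMapReduce.atTopDvd_neBot hK0
    set D : ℕ → ℝ := fun n =>
      p n * (n₁ n : ℝ) ^ 2 + p n * (n₂ n : ℝ) ^ 2 + 2 * q n * (n₁ n : ℝ) * (n₂ n : ℝ) with hD
    have hsum : ∀ n, (n₁ n : ℝ) + n₂ n = n := fun n => by exact_mod_cast hn n
    -- Drop the cross term and use `n₁² + n₂² ≥ (n₁ + n₂)² / 2`.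
    have hDge : ∀ n, p n * (n : ℝ) ^ 2 / 2 ≤ D n := fun n => by
      have h1 : 0 ≤ 2 * q n * (n₁ n : ℝ) * (n₂ n : ℝ) := by
        have := (hq n).le
        positivity
      have h2 : 0 ≤ p n * ((n₁ n : ℝ) - n₂ n) ^ 2 := mul_nonneg (hp0 n).le (sq_nonneg _)
      rw [← hsum]
      simp only [hD]
      linarith
    have hev : ∀ᶠ n in GraphMapReduce.atTopDvd K, 1 ≤ n ∧ K ∣ n :=
      (eventually_ge_atTop 1).filter_mono inf_le_left |>.and
        (mem_inf_of_right (mem_principal_self _))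
    have hDpos : ∀ n, 1 ≤ n → 0 < D n := fun n h => by
      have h1 : (0 : ℝ) < n := by exact_mod_cast h
      have := hp0 n
      exact lt_of_lt_of_le (by positivity) (hDge n)
    have hu : Tendsto (fun n => p n * n / D n) (GraphMapReduce.atTopDvd K) (𝓝 0) := by
      have hlim : Tendsto (fun n : ℕ => 2 * (1 / (n : ℝ))) (GraphMapReduce.atTopDvd K) (𝓝 0) := by
        have := (tendsto_one_div_atTop_nhds_zero_nat (𝕜 := ℝ)).const_mul 2
        rw [mul_zero] at this
        exact this.mono_left inf_le_left
      refine squeeze_zero' (hev.mono fun n h => ?_) (hev.mono fun n h => ?_) hlim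
      · have := hp0 n
        have := hDpos n h.1
        positivity
      · have h1 : (0 : ℝ) < n := by exact_mod_cast h.1
        rw [div_le_iff₀ (hDpos n h.1)]
        calc p n * n = 2 * (1 / n) * (p n * (n : ℝ) ^ 2 / 2) := by field_simp
          _ ≤ _ := by gcongr; exact hDge n
    have hy : Tendsto (fun n => 1 / D n) (GraphMapReduce.atTopDvd K) (𝓝 0) := by
      have hlim := hpω.tendsto_div_nhds_zero.const_mul 2
      rw [mul_zero] at hlim
      refine squeeze_zero' (hev.mono fun n h => ?_) (hev.mono fun n h => ?_) hlim
      · have := hDpos n h.1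
        positivity
      · have h1 : (0 : ℝ) < n := by exact_mod_cast h.1
        have h2 := hp0 n
        rw [div_le_iff₀ (hDpos n h.1)]
        calc 1 = 2 * (1 / (n : ℝ) ^ 2 / p n) * (p n * (n : ℝ) ^ 2 / 2) := by field_simp
          _ ≤ _ := by gcongr; exact hDge n
    -- The bound of `sbmOptLoad_le` divided by the normalization is `F (p n / D, 1 / D)`, with `√m /
    -- D` written as `√((m / D) * (1 / D))`. Both arguments tend to 0, so continuity at the origin
    -- gives the limit.
    let F : ℝ × ℝ → ℝ := fun z => (K.choose (r + 1) : ℝ) * ((r + 1) *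
      (((1 / (K * K.choose r) + 4 * (K + 2) * z.1)
        + (r + 1) * (2 * √((1 / (K * K.choose r) + 4 * (K + 2) * z.1) * z.2))) / r + z.2))
    have hF : Continuous F := by
      simp only [F]
      fun_prop
    have hF0 : F (0, 0) = 1 / (r : ℝ) * (1 - (r : ℝ) / (K : ℝ)) := by
      rw [← GraphMapReduce.choose_identity hr hrK]
      simp [F]
    have hFlim : Tendsto (fun n => F (p n * n / D n, 1 / D n)) (GraphMapReduce.atTopDvd K)
        (𝓝 (1 / (r : ℝ) * (1 - (r : ℝ) / (K : ℝ)))) := by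
      rw [← hF0]
      exact (hF.tendsto (0, 0)).comp (hu.prodMk_nhds hy)
    have hEReal := (continuous_coe_real_ereal.tendsto _).comp hFlim
    rw [← hEReal.limsup_eq]
    refine limsup_le_limsup (hev.mono fun n h => ?_)
    simp only [Function.comp, EReal.coe_le_coe_iff]
    have hn0 : (0 : ℝ) < n := by exact_mod_cast h.1
    have hDn := hDpos n h.1
    have hle := GraphMapReduce.sbmOptLoad_le (n₁ := n₁ n) (n₂ := n₂ n) hr hrK (hT n) (hq n).le (hqp n).le (hp0 n) (hp n)
      (by rw [hn]; exact h.1) (by rw [hn]; exact h.2) equal rfl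
    rw [hsum] at hle ⊢
    change _ / (D n / _) ≤ _
    set m : ℝ := D n / (K * K.choose r) + 4 * (K + 2) * (p n * n) with hm
    have hm1 : 1 / (K * K.choose r) + 4 * (K + 2) * (p n * n / D n) = m / D n := by
      rw [hm]
      field_simp
    have hm2 : √(m / D n * (1 / D n)) = √m / D n := by
      rw [div_mul_div_comm, mul_one, ← sq, Real.sqrt_div' _ (sq_nonneg _), Real.sqrt_sq hDn.le]
    rw [div_le_iff₀ (by positivity)]
    refine hle.trans (le_of_eq ?_)
    simp only [F, hm1, hm2]
    field_simp
  · rw [ge_iff_le, le_div_iff₀ (hq n), mul_comm]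
    have : NeZero K := ⟨hK0.ne'⟩
    have : NeZero (K.choose r) := ⟨(Nat.choose_pos hrK).ne'⟩
    -- The cyclic allocation witnesses that the infimum is over a nonempty set.
    refine le_csInf ⟨_, Set.mem_image_of_mem _
      (GraphMapReduce.cyclicAllocation_mem K r (n₁ n) (n₂ n) hr (by rwa [hn]) equal)⟩ ?_
    rintro _ ⟨A, hA, rfl⟩
    exact GraphMapReduce.avgLoad_ge (hq n).le
      (fun e => (GraphMapReduce.sbmProb_mem (hqp n).le e).1)
      (fun e => (GraphMapReduce.sbmProb_mem (hqp n).le e).2.trans (hp n)) hr hK0 (hT n)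
      (by simpa [hn] using hn0) hA
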